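/- Let $(M,g)$ be a connected smooth Riemannian manifold of dimension $n>2$, and let $T^*M$ be the total space of its cotangent bundle. For $p\in T^*M$ put $t=\tfrac12 g^{-1}_{\pi(p)}(p,p)\in[0,\infty)$. Let $a_1,b_1,a_2,b_2:[0,\infty)\to\mathbb R$ be smooth functions, and let $P$ be the $(1,1)$-tensor field on $T^*M$ given at each $p\in T^*M$, for a tangent vector $X$ and a covector $\alpha$ of $M$ at $\pi(p)$, by $$P X^H_p = a_1(t)\,(X^\flat)^V_p + b_1(t)\,p(X)\,p^V_p,\qquad P\alpha^V_p = a_2(t)\,(\alpha^\sharp)^H_p + b_2(t)\,g^{-1}_{\pi(p)}(p,\alpha)\,(p^\sharp)^H_p,$$ where $V$ denotes the vertical lift, $H$ the horizontal lift with respect to the Levi-Civita connection of $g$, and $\flat,\sharp$ lowering and raising of indices by $g$. Assume that $P$ is an almost product structure, i.e. $P^2=I$. Then $P$ is integrable, i.e. its Nijenhuis tensor $$N_P(X,Y)=[PX,PY]-P[PX,Y]-P[X,PY]+P^2[X,Y]$$ vanishes, if and only if there is a constant $c\in\mathbb R$ such that $(M,g)$ has constant sectional curvature $c$ and, for all $t\ge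 0$, the numbers $a_1-2t\,a_1'$ and $a_1+2c\,t\,a_2$ are nonzero and $$b_1=\frac{a_1a_1'+c}{a_1-2t\,a_1'},\qquad b_2=\frac{a_1a_2'-a_2^2\,c}{a_1+2c\,t\,a_2}.$$ -/

import Mathlib

set_option maxSynthPendingDepth 3

open Set Bundle Manifold
open scoped ContDiff Topology

noncomputable section

namespace NatDiag

/-! ### Local coordinate formulas

Here `E` is the coordinate space `ℝⁿ`, `G q` is the coefficient matrix `(g_ij(q))` of a metric in a
chart, regarded as a bilinear form on `E`, and `G q : E → E*` is also the lowering of indices. -/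

section Local

variable {E : Type*} [NormedAddCommGroup E] [NormedSpace ℝ E]

/-- Raising of indices `♯ : E* → E` for the metric `G` at `q`, i.e. the inverse matrix `g^{ij}(q)`.
(It is the inverse of the lowering of indices `X ↦ G q X`.) -/
def sharp (G : E → E →L[ℝ] E →L[ℝ] ℝ) (q : E) : (E →L[ℝ] ℝ) →L[ℝ] E :=
  (G q).inverse

/-- The trilinear form `(u, v, w) ↦ (∂_w G)(u, v)`. -/
def metricDerivLast (G : E → E →L[ℝ] E →L[ℝ] ℝ) (q : E) : E →L[ℝ] E →L[ℝ] (E →L[ℝ] ℝ) :=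
  (ContinuousLinearMap.flipₗᵢ ℝ E E ℝ).toContinuousLinearEquiv.toContinuousLinearMap ∘L
    (fderiv ℝ G q).flip

/-- Christoffel symbols of the first kind:
`(u, v, w) ↦ ½ ((∂_u G)(v, w) + (∂_v G)(u, w) - (∂_w G)(u, v))`. -/
def christoffelLower (G : E → E →L[ℝ] E →L[ℝ] ℝ) (q : E) : E →L[ℝ] E →L[ℝ] (E →L[ℝ] ℝ) :=
  (1 / 2 : ℝ) • (fderiv ℝ G q + (fderiv ℝ G q).flip - metricDerivLast G q)

/-- Christoffel symbols (of the second kind) of the Levi-Civita connection of `G`: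
`christoffel G q u v = Γ^k_{ij}(q) uⁱ vʲ e_k`. -/
def christoffel (G : E → E →L[ℝ] E →L[ℝ] ℝ) (q : E) : E →L[ℝ] E →L[ℝ] E :=
  (ContinuousLinearMap.compL ℝ E (E →L[ℝ] ℝ) E (sharp G q)) ∘L christoffelLower G q

/-- The curvature tensor `R(u, v) w = ∇_u ∇_v w - ∇_v ∇_u w - ∇_{[u,v]} w` in coordinates. -/
def curvature (G : E → E →L[ℝ] E →L[ℝ] ℝ) (q u v w : E) : E :=
  fderiv ℝ (christoffel G) q u v w - fderiv ℝ (christoffel G) q v u w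
    + christoffel G q u (christoffel G q v w) - christoffel G q v (christoffel G q u w)

/-- The energy density `t = ½ g^{ik}(q) ξ_i ξ_k` of the covector `ξ` at `q`. -/
def energy (G : E → E →L[ℝ] E →L[ℝ] ℝ) (z : E × (E →L[ℝ] ℝ)) : ℝ :=
  (1 / 2) * z.2 (sharp G z.1 z.2)

/-- `Γ⁰(X) = ξ_k Γ^k_{ih} Xⁱ`, as a covector in the index `h`. -/
def gammaZero (G : E → E →L[ℝ] E →L[ℝ] ℝ) (z : E × (E →L[ℝ] ℝ)) : E →L[ℝ] (E →L[ℝ] ℝ) :=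
  (ContinuousLinearMap.compL ℝ E E ℝ z.2) ∘L christoffel G z.1

/-- Horizontal lift of `X` at `z = (q, ξ)`: `Xⁱ δ_i` with `δ_i = ∂/∂qⁱ + ξ_k Γ^k_{ih} ∂/∂p_h`. -/
def horizontalLift (G : E → E →L[ℝ] E →L[ℝ] ℝ) (z : E × (E →L[ℝ] ℝ)) :
    E →L[ℝ] E × (E →L[ℝ] ℝ) :=
  (ContinuousLinearMap.id ℝ E).prod (gammaZero G z)

/-- Vertical lift of a covector `α`: `α_i ∂/∂p_i`. -/
def verticalLift : (E →L[ℝ] ℝ) →L[ℝ] E × (E →L[ℝ] ℝ) :=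
  ContinuousLinearMap.inr ℝ E (E →L[ℝ] ℝ)

/-- The `X` in the decomposition of a tangent vector at `z` as `X^H + α^V`. -/
def horizontalPart : (E × (E →L[ℝ] ℝ)) →L[ℝ] E :=
  ContinuousLinearMap.fst ℝ E (E →L[ℝ] ℝ)

/-- The `α` in the decomposition of a tangent vector at `z` as `X^H + α^V`. -/
def verticalPart (G : E → E →L[ℝ] E →L[ℝ] ℝ) (z : E × (E →L[ℝ] ℝ)) :
    (E × (E →L[ℝ] ℝ)) →L[ℝ] (E →L[ℝ] ℝ) :=
  ContinuousLinearMap.snd ℝ E (E →L[ℝ] ℝ) - gammaZero G z ∘L horizontalPart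

/-- `X ↦ a₁(t) X♭ + b₁(t) ξ(X) ξ`, i.e. the tensor `a₁ g_ij + b₁ p_i p_j`. -/
def lowerTensor (G : E → E →L[ℝ] E →L[ℝ] ℝ) (a₁ b₁ : ℝ → ℝ) (z : E × (E →L[ℝ] ℝ)) :
    E →L[ℝ] (E →L[ℝ] ℝ) :=
  a₁ (energy G z) • G z.1 + b₁ (energy G z) • z.2.smulRight z.2

/-- `α ↦ a₂(t) α♯ + b₂(t) g⁻¹(ξ, α) ξ♯`, i.e. the tensor `a₂ g^{ij} + b₂ g^{0i} g^{0j}`. -/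
def upperTensor (G : E → E →L[ℝ] E →L[ℝ] ℝ) (a₂ b₂ : ℝ → ℝ) (z : E × (E →L[ℝ] ℝ)) :
    (E →L[ℝ] ℝ) →L[ℝ] E :=
  a₂ (energy G z) • sharp G z.1
    + b₂ (energy G z) • (z.2 ∘L sharp G z.1).smulRight (sharp G z.1 z.2)

/-- The natural diagonal lift in the coordinates `(q, p)`:
`P(X^H) = (a₁ X♭ + b₁ ξ(X) ξ)^V` and `P(α^V) = (a₂ α♯ + b₂ g⁻¹(ξ, α) ξ♯)^H`. -/
def localP (G : E → E →L[ℝ] E →L[ℝ] ℝ) (a₁ b₁ a₂ b₂ : ℝ → ℝ) (z : E × (E →L[ℝ] ℝ)) :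
    (E × (E →L[ℝ] ℝ)) →L[ℝ] (E × (E →L[ℝ] ℝ)) :=
  verticalLift ∘L lowerTensor G a₁ b₁ z ∘L horizontalPart
    + horizontalLift G z ∘L upperTensor G a₂ b₂ z ∘L verticalPart G z

end Local

/-! ### Global objects on a Riemannian manifold and its cotangent bundle -/

section Global

variable {E : Type*} [NormedAddCommGroup E] [NormedSpace ℝ E]
  {M : Type*} [TopologicalSpace M] [ChartedSpace E M] [IsManifold 𝓘(ℝ, E) ∞ M]

/-- Coefficients of the metric `g` in the preferred chart at `x₀`: at a point `q` of the chart
domain in `E`, the form `(u, v) ↦ g(∂_u, ∂_v)`, with `∂_u` the coordinate vector field of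
direction `u`, i.e. the image of `u` under the differential of the inverse of the chart. -/
def chartMetric (g : ContMDiffRiemannianMetric 𝓘(ℝ, E) ∞ E (fun x : M ↦ TangentSpace 𝓘(ℝ, E) x))
    (x₀ : M) (q : E) : E →L[ℝ] E →L[ℝ] ℝ :=
  let D : E →L[ℝ] TangentSpace 𝓘(ℝ, E) ((extChartAt 𝓘(ℝ, E) x₀).symm q) :=
    mfderiv 𝓘(ℝ, E) 𝓘(ℝ, E) (extChartAt 𝓘(ℝ, E) x₀).symm q
  (ContinuousLinearMap.precomp ℝ D) ∘L g.inner ((extChartAt 𝓘(ℝ, E) x₀).symm q) ∘L D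

/-- The sectional curvature of the plane spanned by the (linearly independent) tangent vectors
`u, v` at `x`: `g(R(u, v) v, u) / (g(u, u) g(v, v) - g(u, v)²)`, computed in the chart at `x`. -/
def sectionalCurvature
    (g : ContMDiffRiemannianMetric 𝓘(ℝ, E) ∞ E (fun x : M ↦ TangentSpace 𝓘(ℝ, E) x))
    (x : M) (u v : TangentSpace 𝓘(ℝ, E) x) : ℝ :=
  let q : E := extChartAt 𝓘(ℝ, E) x x
  let D : TangentSpace 𝓘(ℝ, E) x →L[ℝ] E := mfderiv 𝓘(ℝ, E) 𝓘(ℝ, E) (extChartAt 𝓘(ℝ, E) x) x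
  chartMetric g x q (curvature (chartMetric g x) q (D u) (D v) (D v)) (D u)
    / (g.inner x u u * g.inner x v v - g.inner x u v ^ 2)

/-- `(M, g)` has constant sectional curvature `c`. -/
def HasConstantSectionalCurvature
    (g : ContMDiffRiemannianMetric 𝓘(ℝ, E) ∞ E (fun x : M ↦ TangentSpace 𝓘(ℝ, E) x))
    (c : ℝ) : Prop :=
  ∀ (x : M) (u v : TangentSpace 𝓘(ℝ, E) x), LinearIndependent ℝ ![u, v] →
    sectionalCurvature g x u v = c

variable (E M) in
/-- The total space `T*M` of the cotangent bundle, with Mathlib's manifold structure on the total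
space of a vector bundle: its charts are the charts `(q, p)` induced by the charts of `M`. -/
abbrev CotangentBundle : Type _ :=
  TotalSpace (E →L[ℝ] ℝ) (fun x : M ↦ TangentSpace 𝓘(ℝ, E) x →L[ℝ] Bundle.Trivial M ℝ x)

variable (E) in
/-- The model with corners of `T*M`. -/
abbrev cotangentModel : ModelWithCorners ℝ (E × (E →L[ℝ] ℝ)) (ModelProd E (E →L[ℝ] ℝ)) :=
  𝓘(ℝ, E).prod 𝓘(ℝ, E →L[ℝ] ℝ)

/-- A field of endomorphisms of the tangent spaces of `T*M`. -/
abbrev EndField (E M : Type*) [NormedAddCommGroup E] [NormedSpace ℝ E]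
    [TopologicalSpace M] [ChartedSpace E M] [IsManifold 𝓘(ℝ, E) ∞ M] : Type _ :=
  (p : CotangentBundle E M) →
    TangentSpace (cotangentModel E) p →L[ℝ] TangentSpace (cotangentModel E) p

/-- The natural diagonal lift `P` of the metric to `T*M` with coefficients `a₁, b₁, a₂, b₂`. At the
point `p` it is given by the coordinate formula `localP` in the chart `(q, p)` of `T*M` induced by
the chart of `M` at the base point of `p`. (The formula is invariant under changes of charts.) -/
def naturalDiagonalLift
    (g : ContMDiffRiemannianMetric 𝓘(ℝ, E) ∞ E (fun x : M ↦ TangentSpace 𝓘(ℝ, E) x))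
    (a₁ b₁ a₂ b₂ : ℝ → ℝ) : EndField E M := fun p ↦
  let D : TangentSpace (cotangentModel E) p →L[ℝ] E × (E →L[ℝ] ℝ) :=
    mfderiv (cotangentModel E) 𝓘(ℝ, E × (E →L[ℝ] ℝ)) (extChartAt (cotangentModel E) p) p
  D.inverse ∘L
    localP (chartMetric g p.proj) a₁ b₁ a₂ b₂ (extChartAt (cotangentModel E) p p) ∘L D

/-- `P` is an almost product structure: `P² = I`. -/
def IsAlmostProduct (P : EndField E M) : Prop :=
  ∀ (p : CotangentBundle E M) (v : TangentSpace (cotangentModel E) p), P p (P p v) = v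

/-- The Nijenhuis tensor `N_P(X, Y) = [PX, PY] - P[PX, Y] - P[X, PY] + P²[X, Y]`. -/
def nijenhuis (P : EndField E M)
    (X Y : (p : CotangentBundle E M) → TangentSpace (cotangentModel E) p)
    (p : CotangentBundle E M) : TangentSpace (cotangentModel E) p :=
  VectorField.mlieBracket (cotangentModel E) (fun z ↦ P z (X z)) (fun z ↦ P z (Y z)) p
    - P p (VectorField.mlieBracket (cotangentModel E) (fun z ↦ P z (X z)) Y p)
    - P p (VectorField.mlieBracket (cotangentModel E) X (fun z ↦ P z (Y z)) p)
    + P p (P p (VectorField.mlieBracket (cotangentModel E) X Y p))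

/-- `P` is integrable: its Nijenhuis tensor vanishes, i.e. `N_P(X, Y) = 0` at every point `p`, for
all vector fields `X, Y` on `T*M` that are smooth at `p`. -/
def IsIntegrable (P : EndField E M) : Prop :=
  ∀ (X Y : (p : CotangentBundle E M) → TangentSpace (cotangentModel E) p)
    (p : CotangentBundle E M),
    ContMDiffAt (cotangentModel E) (cotangentModel E).tangent ∞
      (fun z ↦ (⟨z, X z⟩ : TangentBundle (cotangentModel E) (CotangentBundle E M))) p →
    ContMDiffAt (cotangentModel E) (cotangentModel E).tangent ∞
      (fun z ↦ (⟨z, Y z⟩ : TangentBundle (cotangentModel E) (CotangentBundle E M))) p →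
    nijenhuis P X Y p = 0

end Global

end NatDiag

end

/-!
The proof is a computation of the Nijenhuis tensor `N` of `P` in the charts `(q, p)` of `T*M`.

**Reduction to coordinates.** The field `P` is defined pointwise, at each point in its own chart.
The transformation law of the Christoffel symbols (`christoffel_change_coordinates`) shows that the
formula `localP` is invariant under changes of charts (`localP_change_coordinates`,
`chartDeriv_naturalDiagonalLift`). So near `p` the field is smooth and given by `localP` in the
chart at `p`, and since `N` is tensorial it vanishes iff the form
`(u, v) ↦ DP(P u) v - DP(P v) u + P (DP(v) u) - P (DP(u) v)` does
(`isIntegrable_iff_nijenhuisForm`).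

**The curvature equation.** As `P² = I`, one has `N(P X, Y) = -P N(X, Y)`, and `P` exchanges
horizontal and vertical vectors, so `N` is determined by its values on horizontal lifts. Write `L`
for the tensor `a₁ g_ij + b₁ p_i p_j`. In `N(X^H, Y^H)` the mixed brackets cancel, since `L` is
parallel in horizontal directions (`fderiv_lowerTensor`) and the connection is torsion free. The
remaining terms `[(L X)^V, (L Y)^V] + [X^H, Y^H]` are, on a vector `Z`,
`κ(t) (p(X) g(Y, Z) - p(Y) g(X, Z)) + p(R(X, Y) Z)`, with `κ = a₁' (a₁ + 2 t b₁) - a₁ b₁`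
(`torsionCoeff`, `nijenhuisForm_horizontalLift`).

**Constant curvature.** If `N = 0`, taking for `p` the multiple of `X♭` of energy density `t` shows
that every sectional curvature is equal to `-κ(t)`, for every `t > 0`
(`IsIntegrable.apply_curvature_eq`). The curvature is therefore a constant `c`, without appeal to
Schur's lemma, and `κ = -c` on `[0, ∞)` by continuity. Conversely, constant sectional curvature `c`
determines `R` by polarization (`curvatureLike_eq_zero`), and then `κ = -c` gives `N = 0`.

**The coefficients.** `P² = I` says that `a₁ a₂ = 1` and `a₂ b₁ + a₁ b₂ + 2 t b₁ b₂ = 0`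
(`IsAlmostProduct.coefficients`). Given this, `κ = -c` is equivalent to the formulas for `b₁` and
`b₂`, once the denominators are known not to vanish. They are nonzero multiples of
`h = a₁² + 2 c t`; this function solves a homogeneous linear differential equation and has
`h(0) ≠ 0`, so it has no zeros (`coefficients_of_torsionCoeff`).
-/

noncomputable section

namespace NatDiag

/-! ### Local metrics and their Christoffel symbols -/

section LocalMetric

variable {E : Type*} [NormedAddCommGroup E] [NormedSpace ℝ E]

/-- `G` is the coefficient matrix of a smooth Riemannian metric on the open subset `U` of the
coordinate space. -/
structure IsMetricOn (G : E → E →L[ℝ] E →L[ℝ] ℝ) (U : Set E) : Prop where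
  isOpen : IsOpen U
  contDiffOn : ContDiffOn ℝ ∞ G U
  symm : ∀ q ∈ U, ∀ u v, G q u v = G q v u
  pos : ∀ q ∈ U, ∀ v, v ≠ 0 → 0 < G q v v

variable {G : E → E →L[ℝ] E →L[ℝ] ℝ} {U : Set E} {q : E}

theorem christoffelLower_apply (G : E → E →L[ℝ] E →L[ℝ] ℝ) (q u v w : E) :
    christoffelLower G q u v w =
      (1 / 2) * (fderiv ℝ G q u v w + fderiv ℝ G q v u w - fderiv ℝ G q w u v) := rfl

theorem christoffel_apply (G : E → E →L[ℝ] E →L[ℝ] ℝ) (q u v : E) :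
    christoffel G q u v = sharp G q (christoffelLower G q u v) := rfl

namespace IsMetricOn

theorem contDiffAt (hG : IsMetricOn G U) (hq : q ∈ U) : ContDiffAt ℝ ∞ G q :=
  hG.contDiffOn.contDiffAt (hG.isOpen.mem_nhds hq)

theorem differentiableAt (hG : IsMetricOn G U) (hq : q ∈ U) : DifferentiableAt ℝ G q :=
  (hG.contDiffAt hq).differentiableAt (by simp)

theorem fderiv_symm (hG : IsMetricOn G U) (hq : q ∈ U) (w u v : E) :
    fderiv ℝ G q w u v = fderiv ℝ G q w v u := by
  have h1 (u v : E) : HasFDerivAt (fun x ↦ G x u v) (((fderiv ℝ G q).flip u).flip v) q := by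
    have := ((hG.differentiableAt hq).hasFDerivAt.clm_apply (hasFDerivAt_const u q)).clm_apply
      (hasFDerivAt_const v q)
    refine this.congr_fderiv ?_
    ext; simp
  have h2 : (fun x ↦ G x u v) =ᶠ[𝓝 q] fun x ↦ G x v u :=
    Filter.eventually_of_mem (hG.isOpen.mem_nhds hq) fun x hx ↦ hG.symm x hx u v
  have := DFunLike.congr_fun ((h1 u v).unique ((h1 v u).congr_of_eventuallyEq h2)) w
  simpa using this

theorem injective (hG : IsMetricOn G U) (hq : q ∈ U) : Function.Injective (G q) := by
  rw [injective_iff_map_eq_zero]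
  intro v hv
  by_contra h
  have := hG.pos q hq v h
  simp [hv] at this

theorem eq_of_apply_eq (hG : IsMetricOn G U) (hq : q ∈ U) {u v : E} (h : ∀ w, G q u w = G q v w) :
    u = v :=
  hG.injective hq (ContinuousLinearMap.ext h)

theorem contDiffAt_fderiv (hG : IsMetricOn G U) (hq : q ∈ U) : ContDiffAt ℝ ∞ (fderiv ℝ G) q :=
  (hG.contDiffAt hq).fderiv_right (by simp)

variable [FiniteDimensional ℝ E]

theorem isInvertible (hG : IsMetricOn G U) (hq : q ∈ U) : (G q).IsInvertible := by
  have hd : Module.finrank ℝ E = Module.finrank ℝ (E →L[ℝ] ℝ) := by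
    rw [← (LinearMap.toContinuousLinearMap (𝕜 := ℝ) (E := E) (F' := ℝ)).finrank_eq]
    exact (Subspace.dual_finrank_eq).symm
  exact ⟨(LinearMap.linearEquivOfInjective (G q : E →ₗ[ℝ] (E →L[ℝ] ℝ)) (hG.injective hq)
    hd).toContinuousLinearEquiv, by ext; rfl⟩

theorem apply_sharp (hG : IsMetricOn G U) (hq : q ∈ U) (α : E →L[ℝ] ℝ) :
    G q (sharp G q α) = α :=
  (hG.isInvertible hq).self_apply_inverse α

theorem sharp_apply (hG : IsMetricOn G U) (hq : q ∈ U) (u : E) : sharp G q (G q u) = u :=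
  (hG.isInvertible hq).inverse_apply_self u

theorem apply_christoffel (hG : IsMetricOn G U) (hq : q ∈ U) (u v w : E) :
    G q (christoffel G q u v) w =
      (1 / 2) * (fderiv ℝ G q u v w + fderiv ℝ G q v u w - fderiv ℝ G q w u v) := by
  rw [christoffel_apply, hG.apply_sharp hq, christoffelLower_apply]

/-- The Levi-Civita connection is torsion free. -/
theorem christoffel_comm (hG : IsMetricOn G U) (hq : q ∈ U) (u v : E) :
    christoffel G q u v = christoffel G q v u := by
  refine hG.eq_of_apply_eq hq fun w ↦ ?_
  rw [hG.apply_christoffel hq, hG.apply_christoffel hq, hG.fderiv_symm hq w u v]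
  ring

/-- The Levi-Civita connection is metric. -/
theorem fderiv_apply (hG : IsMetricOn G U) (hq : q ∈ U) (w u v : E) :
    fderiv ℝ G q w u v = G q (christoffel G q w u) v + G q u (christoffel G q w v) := by
  rw [hG.symm q hq u, hG.apply_christoffel hq, hG.apply_christoffel hq, hG.fderiv_symm hq w u v]
  ring

theorem contDiffAt_sharp (hG : IsMetricOn G U) (hq : q ∈ U) : ContDiffAt ℝ ∞ (sharp G) q := by
  obtain ⟨e, he⟩ := hG.isInvertible hq
  have := (hG.isInvertible hq).contDiffAt_map_inverse (n := ∞)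
  exact this.comp q (hG.contDiffAt hq)

set_option synthInstance.maxHeartbeats 200000 in
theorem contDiffAt_christoffel (hG : IsMetricOn G U) (hq : q ∈ U) :
    ContDiffAt ℝ ∞ (christoffel G) q := by
  have hd := hG.contDiffAt_fderiv hq
  have hl : ContDiffAt ℝ ∞ (christoffelLower G) q := by
    refine ContDiffAt.const_smul _ ((hd.add ?_).sub ?_)
    · exact (ContinuousLinearMap.flipₗᵢ ℝ E E (E →L[ℝ] ℝ)).contDiff.contDiffAt.comp q hd
    · exact contDiffAt_const.clm_comp
        ((ContinuousLinearMap.flipₗᵢ ℝ E E (E →L[ℝ] ℝ)).contDiff.contDiffAt.comp q hd)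
  have hs : ContDiffAt ℝ ∞
      (fun q ↦ ContinuousLinearMap.compL ℝ E (E →L[ℝ] ℝ) E (sharp G q)) q :=
    (ContinuousLinearMap.compL ℝ E (E →L[ℝ] ℝ) E).contDiff.contDiffAt.comp q
      (hG.contDiffAt_sharp hq)
  exact hs.clm_comp hl

end IsMetricOn
end LocalMetric

/-! ### The natural diagonal lift in coordinates and changes of charts -/

section LocalLift

variable {E : Type*} [NormedAddCommGroup E] [NormedSpace ℝ E]
variable {G : E → E →L[ℝ] E →L[ℝ] ℝ} {U : Set E} {q : E} {a₁ b₁ a₂ b₂ : ℝ → ℝ}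

theorem gammaZero_apply (G : E → E →L[ℝ] E →L[ℝ] ℝ) (z : E × (E →L[ℝ] ℝ)) (u v : E) :
    gammaZero G z u v = z.2 (christoffel G z.1 u v) := rfl

theorem lowerTensor_apply (G : E → E →L[ℝ] E →L[ℝ] ℝ) (a₁ b₁ : ℝ → ℝ) (z : E × (E →L[ℝ] ℝ))
    (u v : E) : lowerTensor G a₁ b₁ z u v =
      a₁ (energy G z) * G z.1 u v + b₁ (energy G z) * (z.2 u * z.2 v) := rfl

theorem upperTensor_apply (G : E → E →L[ℝ] E →L[ℝ] ℝ) (a₂ b₂ : ℝ → ℝ) (z : E × (E →L[ℝ] ℝ))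
    (α : E →L[ℝ] ℝ) : upperTensor G a₂ b₂ z α =
      a₂ (energy G z) • sharp G z.1 α
        + b₂ (energy G z) • z.2 (sharp G z.1 α) • sharp G z.1 z.2 := rfl

theorem localP_apply (G : E → E →L[ℝ] E →L[ℝ] ℝ) (a₁ b₁ a₂ b₂ : ℝ → ℝ) (z v : E × (E →L[ℝ] ℝ)) :
    localP G a₁ b₁ a₂ b₂ z v =
      (upperTensor G a₂ b₂ z (v.2 - gammaZero G z v.1),
        lowerTensor G a₁ b₁ z v.1
          + gammaZero G z (upperTensor G a₂ b₂ z (v.2 - gammaZero G z v.1))) := by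
  simp [localP, verticalLift, horizontalLift, horizontalPart, verticalPart]

theorem fderiv_bilin_apply {A : E → E →L[ℝ] E →L[ℝ] ℝ} {x : E} (hA : DifferentiableAt ℝ A x)
    {f g : E → E} {f' g' : E →L[ℝ] E} (hf : HasFDerivAt f f' x) (hg : HasFDerivAt g g' x) (w : E) :
    fderiv ℝ (fun y ↦ A y (f y) (g y)) x w =
      fderiv ℝ A x w (f x) (g x) + A x (f' w) (g x) + A x (f x) (g' w) := by
  rw [((hA.hasFDerivAt.clm_apply hf).clm_apply hg).fderiv]
  simp
  ring

/-- Differential of the map `(q, ξ) ↦ (k q, ξ ∘ Dh(k q))` induced on covectors by a change of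
coordinates `k` with inverse `h`. -/
theorem hasFDerivAt_covector_change {h k : E → E} {q : E} {k' : E →L[ℝ] E}
    (hh : ContDiffAt ℝ ∞ h (k q)) (hk : HasFDerivAt k k' q) (ξ : E →L[ℝ] ℝ) :
    HasFDerivAt (fun z : E × (E →L[ℝ] ℝ) ↦ (k z.1, z.2 ∘L fderiv ℝ h (k z.1)))
      ((k' ∘L ContinuousLinearMap.fst ℝ E (E →L[ℝ] ℝ)).prod
        ((ContinuousLinearMap.compL ℝ E E ℝ).flip (fderiv ℝ h (k q)) ∘L
            ContinuousLinearMap.snd ℝ E (E →L[ℝ] ℝ)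
          + ContinuousLinearMap.compL ℝ E E ℝ ξ ∘L fderiv ℝ (fderiv ℝ h) (k q) ∘L k' ∘L
            ContinuousLinearMap.fst ℝ E (E →L[ℝ] ℝ))) (q, ξ) := by
  have hd2 : DifferentiableAt ℝ (fderiv ℝ h) (k q) :=
    (hh.fderiv_right (m := ∞) (by simp)).differentiableAt (by simp)
  have h1 : HasFDerivAt (fun z : E × (E →L[ℝ] ℝ) ↦ k z.1)
      (k' ∘L ContinuousLinearMap.fst ℝ E (E →L[ℝ] ℝ)) (q, ξ) :=
    HasFDerivAt.comp (q, ξ) hk hasFDerivAt_fst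
  have h2 : HasFDerivAt (fun z : E × (E →L[ℝ] ℝ) ↦ fderiv ℝ h (k z.1))
      (fderiv ℝ (fderiv ℝ h) (k q) ∘L k' ∘L ContinuousLinearMap.fst ℝ E (E →L[ℝ] ℝ)) (q, ξ) :=
    HasFDerivAt.comp (q, ξ) hd2.hasFDerivAt h1
  refine (h1.prodMk (hasFDerivAt_snd.clm_comp h2)).congr_fderiv ?_
  ext <;> simp

variable [FiniteDimensional ℝ E] {G₀ G₁ : E → E →L[ℝ] E →L[ℝ] ℝ} {U₀ U₁ : Set E}

/-- The transformation law of the Christoffel symbols under a change of coordinates `h`. -/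
theorem christoffel_change_coordinates (h₀ : IsMetricOn G₀ U₀) (h₁ : IsMetricOn G₁ U₁) {h : E → E}
    (hq : q ∈ U₀) (hhq : h q ∈ U₁) (hh : ContDiffAt ℝ ∞ h q)
    (hG : ∀ᶠ x in 𝓝 q, ∀ u v, G₀ x u v = G₁ (h x) (fderiv ℝ h x u) (fderiv ℝ h x v))
    (hs : Function.Surjective (fderiv ℝ h q)) (u v : E) :
    fderiv ℝ h q (christoffel G₀ q u v) = fderiv ℝ (fderiv ℝ h) q u v
      + christoffel G₁ (h q) (fderiv ℝ h q u) (fderiv ℝ h q v) := by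
  have hd : DifferentiableAt ℝ h q := hh.differentiableAt (by simp)
  have hd2 : DifferentiableAt ℝ (fderiv ℝ h) q :=
    (hh.fderiv_right (m := ∞) (by simp)).differentiableAt (by simp)
  have hsymm (u v : E) : fderiv ℝ (fderiv ℝ h) q u v = fderiv ℝ (fderiv ℝ h) q v u :=
    (hh.isSymmSndFDerivAt (by simpa using ENat.LEInfty.out)).eq u v
  have hev (u : E) : HasFDerivAt (fun x ↦ fderiv ℝ h x u) ((fderiv ℝ (fderiv ℝ h) q).flip u) q :=
    (hd2.hasFDerivAt.clm_apply (hasFDerivAt_const u q)).congr_fderiv (by ext; simp)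
  have key (w u v : E) : fderiv ℝ G₀ q w u v =
      fderiv ℝ G₁ (h q) (fderiv ℝ h q w) (fderiv ℝ h q u) (fderiv ℝ h q v)
        + G₁ (h q) (fderiv ℝ (fderiv ℝ h) q w u) (fderiv ℝ h q v)
        + G₁ (h q) (fderiv ℝ h q u) (fderiv ℝ (fderiv ℝ h) q w v) := by
    have e1 := fderiv_bilin_apply (h₀.differentiableAt hq) (hasFDerivAt_const u q)
      (hasFDerivAt_const v q) w
    have e2 := fderiv_bilin_apply
      ((h₁.differentiableAt hhq).comp q hd) (hev u) (hev v) w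
    rw [Filter.EventuallyEq.fderiv_eq
      (show (fun x ↦ G₀ x u v) =ᶠ[𝓝 q] _ from hG.mono fun x hx ↦ hx u v)] at e1
    rw [fderiv_comp q (h₁.differentiableAt hhq) hd] at e2
    have e3 := e1.symm.trans e2
    simpa using e3
  refine h₁.eq_of_apply_eq hhq fun w' ↦ ?_
  obtain ⟨w, rfl⟩ := hs w'
  rw [← hG.self_of_nhds, h₀.apply_christoffel hq, map_add, add_apply,
    h₁.apply_christoffel hhq, key, key, key, hsymm w u, hsymm w v, hsymm v u,
    h₁.symm _ hhq (fderiv ℝ h q v)]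
  ring

/-- Invariance of the coordinate expression of the natural diagonal lift under the change of
coordinates of `T*M` induced by a change of coordinates `k` of `M` with inverse `h`. -/
theorem localP_change_coordinates (h₀ : IsMetricOn G₀ U₀) (h₁ : IsMetricOn G₁ U₁) {h k : E → E}
    {k' : E →L[ℝ] E} (hq : k q ∈ U₀) (hhq : q ∈ U₁) (hkh : h (k q) = q)
    (hh : ContDiffAt ℝ ∞ h (k q)) (hk : HasFDerivAt k k' q)
    (hG : ∀ᶠ x in 𝓝 (k q), ∀ u v, G₀ x u v = G₁ (h x) (fderiv ℝ h x u) (fderiv ℝ h x v))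
    (hl : ∀ u, fderiv ℝ h (k q) (k' u) = u)
    (ξ : E →L[ℝ] ℝ) (v : E × (E →L[ℝ] ℝ)) :
    let Ψ := fun z : E × (E →L[ℝ] ℝ) ↦ (k z.1, z.2 ∘L fderiv ℝ h (k z.1))
    localP G₀ a₁ b₁ a₂ b₂ (Ψ (q, ξ)) (fderiv ℝ Ψ (q, ξ) v) =
      fderiv ℝ Ψ (q, ξ) (localP G₁ a₁ b₁ a₂ b₂ (q, ξ) v) := by
  intro Ψ
  have hΨ := (hasFDerivAt_covector_change hh hk ξ).fderiv
  have hs : Function.Surjective (fderiv ℝ h (k q)) := fun u ↦ ⟨k' u, hl u⟩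
  have hΓ := christoffel_change_coordinates h₀ h₁ hq (hkh.symm ▸ hhq) hh hG hs
  have hGq := hG.self_of_nhds
  rw [hkh] at hΓ hGq
  set A := fderiv ℝ h (k q) with hA
  have hsharp (β : E →L[ℝ] ℝ) : sharp G₀ (k q) (β ∘L A) = k' (sharp G₁ q β) := by
    refine h₀.eq_of_apply_eq hq fun w ↦ ?_
    rw [h₀.apply_sharp hq, hGq, hl, h₁.apply_sharp hhq]
    rfl
  have hE : energy G₀ (k q, ξ ∘L A) = energy G₁ (q, ξ) := by
    simp [energy, hsharp, hl]
  have hL (u : E) : lowerTensor G₀ a₁ b₁ (k q, ξ ∘L A) (k' u) =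
      lowerTensor G₁ a₁ b₁ (q, ξ) u ∘L A := by
    ext w
    simp [lowerTensor_apply, hE, hGq, hl]
  have hU (β : E →L[ℝ] ℝ) : upperTensor G₀ a₂ b₂ (k q, ξ ∘L A) (β ∘L A) =
      k' (upperTensor G₁ a₂ b₂ (q, ξ) β) := by
    simp [upperTensor_apply, hE, hsharp, hl]
  have hΓ₀ (u : E) : gammaZero G₀ (k q, ξ ∘L A) (k' u) =
      ξ ∘L fderiv ℝ (fderiv ℝ h) (k q) (k' u) + gammaZero G₁ (q, ξ) u ∘L A := by
    ext w
    simp [gammaZero_apply, hΓ, hl]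
  have e1 (w : E × (E →L[ℝ] ℝ)) : fderiv ℝ Ψ (q, ξ) w =
      (k' w.1, w.2 ∘L A + ξ ∘L fderiv ℝ (fderiv ℝ h) (k q) (k' w.1)) := by
    rw [hΨ]; rfl
  have e2 : Ψ (q, ξ) = (k q, ξ ∘L A) := rfl
  have e3 : v.2 ∘L A + ξ ∘L fderiv ℝ (fderiv ℝ h) (k q) (k' v.1) -
      (ξ ∘L fderiv ℝ (fderiv ℝ h) (k q) (k' v.1) + gammaZero G₁ (q, ξ) v.1 ∘L A) =
      (v.2 - gammaZero G₁ (q, ξ) v.1) ∘L A := by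
    ext w; simp; ring
  rw [e1, e1, e2, localP_apply, localP_apply]
  simp only [hΓ₀, e3, hU, hL]
  ext1
  · rfl
  · ext w
    simp
    ring

end LocalLift

/-! ### Charts of the cotangent bundle and the metric in a chart -/

section Manifold
variable {E : Type*} [NormedAddCommGroup E] [NormedSpace ℝ E]
  {M : Type*} [TopologicalSpace M] [ChartedSpace E M] [IsManifold 𝓘(ℝ, E) ∞ M]

/-- The chart of `T*M` at `p` sends a covector `w` to `(q, ξ)`, where `q` are the coordinates of its
base point and `ξ` is its pullback along the inverse of the chart of `M`. -/
theorem extChartAt_cotangent_apply (p w : CotangentBundle E M)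
    (hw : w.proj ∈ (chartAt E p.proj).source) :
    extChartAt (cotangentModel E) p w = (extChartAt 𝓘(ℝ, E) p.proj w.proj,
      w.2 ∘L (mfderiv 𝓘(ℝ, E) 𝓘(ℝ, E) (extChartAt 𝓘(ℝ, E) p.proj).symm
        (extChartAt 𝓘(ℝ, E) p.proj w.proj) : E →L[ℝ] TangentSpace 𝓘(ℝ, E) w.proj)) := by
  rw [FiberBundle.extChartAt]
  have h := TangentBundle.symmL_trivializationAt (I := 𝓘(ℝ, E)) hw
  simp only [mfld_simps]
  rw [hom_trivializationAt_apply]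
  ext1
  · simp
  · simp only [ContinuousLinearMap.inCoordinates, h]
    ext v
    simp
    rfl

variable (g : ContMDiffRiemannianMetric 𝓘(ℝ, E) ∞ E (fun x : M ↦ TangentSpace 𝓘(ℝ, E) x))

/-- The definition of `chartMetric`, with the base point replaced by a point equal to it, so that it
can be rewritten. -/
theorem chartMetric_apply {x₀ y : M} {q : E} (h : (extChartAt 𝓘(ℝ, E) x₀).symm q = y) (u v : E) :
    chartMetric g x₀ q u v =
      g.inner y (mfderiv 𝓘(ℝ, E) 𝓘(ℝ, E) (extChartAt 𝓘(ℝ, E) x₀).symm q u : E)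
        (mfderiv 𝓘(ℝ, E) 𝓘(ℝ, E) (extChartAt 𝓘(ℝ, E) x₀).symm q v : E) := by
  subst h
  rfl

/-- The metric coefficients are the section `g` in the trivialization at `x₀` of the bundle of
bilinear forms. This gives their smoothness. -/
theorem chartMetric_extChartAt_eq {x₀ y : M} (h : y ∈ (chartAt E x₀).source) :
    chartMetric g x₀ (extChartAt 𝓘(ℝ, E) x₀ y) =
      (trivializationAt (E →L[ℝ] E →L[ℝ] ℝ)
        (fun x : M ↦ TangentSpace 𝓘(ℝ, E) x →L[ℝ] TangentSpace 𝓘(ℝ, E) x →L[ℝ] ℝ) x₀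
        ⟨y, g.inner y⟩).2 := by
  have h1 := TangentBundle.symmL_trivializationAt (I := 𝓘(ℝ, E)) h
  ext u v
  rw [chartMetric_apply g (y := y) ((extChartAt 𝓘(ℝ, E) x₀).left_inv (by simpa using h))]
  rw [hom_trivializationAt_apply]
  rw [inCoordinates_apply_eq₂ (by simpa using h) (by simpa using h) (by simp)]
  rw [modelWithCornersSelf_coe, range_id, mfderivWithin_univ] at h1
  rw [← h1]
  simp
  have h2 (w : E) := Trivialization.symmL_apply (R := ℝ)
    (trivializationAt E (TangentSpace 𝓘(ℝ, E)) x₀) (b := y) (by simpa using h) w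
  erw [h2 u, h2 v]

theorem contDiffOn_chartMetric (x₀ : M) :
    ContDiffOn ℝ ∞ (chartMetric g x₀) (extChartAt 𝓘(ℝ, E) x₀).target := by
  intro q hq
  set y := (extChartAt 𝓘(ℝ, E) x₀).symm q with hy
  have hys : y ∈ (chartAt E x₀).source := by
    simpa [hy] using (extChartAt 𝓘(ℝ, E) x₀).map_target hq
  have h1 := (Trivialization.contMDiffAt_section_iff (n := ∞)
    (trivializationAt (E →L[ℝ] E →L[ℝ] ℝ)
        (fun x : M ↦ TangentSpace 𝓘(ℝ, E) x →L[ℝ] TangentSpace 𝓘(ℝ, E) x →L[ℝ] ℝ) x₀)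
    (s := g.inner) (x₀ := y) (IB := 𝓘(ℝ, E)) (by simpa using hys)).1 (g.contMDiff y)
  have h2 := (contMDiffOn_extChartAt_symm (I := 𝓘(ℝ, E)) (n := ∞) x₀).contMDiffAt
    ((isOpen_extChartAt_target x₀).mem_nhds hq)
  have h3 := (ContMDiffAt.comp q h1 h2).contDiffAt.contDiffWithinAt
    (s := (extChartAt 𝓘(ℝ, E) x₀).target)
  refine h3.congr_of_mem (fun z hz ↦ ?_) hq
  have := chartMetric_extChartAt_eq g (y := (extChartAt 𝓘(ℝ, E) x₀).symm z)
    (by simpa using (extChartAt 𝓘(ℝ, E) x₀).map_target hz)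
  rw [(extChartAt 𝓘(ℝ, E) x₀).right_inv hz] at this
  rw [this]
  rfl

theorem isInvertible_mfderiv_extChartAt_symm {x₀ : M} {q : E}
    (hq : q ∈ (extChartAt 𝓘(ℝ, E) x₀).target) :
    (mfderiv 𝓘(ℝ, E) 𝓘(ℝ, E) (extChartAt 𝓘(ℝ, E) x₀).symm q).IsInvertible := by
  simpa using isInvertible_mfderivWithin_extChartAt_symm (I := 𝓘(ℝ, E)) hq

theorem isMetricOn_chartMetric (x₀ : M) :
    IsMetricOn (chartMetric g x₀) (extChartAt 𝓘(ℝ, E) x₀).target where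
  isOpen := isOpen_extChartAt_target x₀
  contDiffOn := contDiffOn_chartMetric g x₀
  symm q _ u v := g.symm _ _ _
  pos q hq v hv := by
    refine g.pos _ _ fun h ↦ hv ?_
    exact (isInvertible_mfderiv_extChartAt_symm hq).injective (h.trans (map_zero _).symm)

end Manifold

/-! ### Invariance of the natural diagonal lift under changes of charts -/

section ChartInvariance
variable {E : Type*} [NormedAddCommGroup E] [NormedSpace ℝ E]
  {M : Type*} [TopologicalSpace M] [ChartedSpace E M] [IsManifold 𝓘(ℝ, E) ∞ M]

/-- The transition map from the chart at `x₀` to the chart at `x₁`. -/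
def chartTransition (x₀ x₁ : M) (q : E) : E :=
  extChartAt 𝓘(ℝ, E) x₁ ((extChartAt 𝓘(ℝ, E) x₀).symm q)

omit [IsManifold 𝓘(ℝ, E) ∞ M] in
theorem chartTransition_extChartAt {x₀ x₁ y : M} (h₀ : y ∈ (chartAt E x₀).source) :
    chartTransition x₀ x₁ (extChartAt 𝓘(ℝ, E) x₀ y) = extChartAt 𝓘(ℝ, E) x₁ y := by
  rw [chartTransition, (extChartAt 𝓘(ℝ, E) x₀).left_inv (by simpa using h₀)]

theorem contDiffAt_chartTransition {x₀ x₁ y : M} (h₀ : y ∈ (chartAt E x₀).source)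
    (h₁ : y ∈ (chartAt E x₁).source) :
    ContDiffAt ℝ ∞ (chartTransition x₀ x₁) (extChartAt 𝓘(ℝ, E) x₀ y) := by
  have h0' : y ∈ (extChartAt 𝓘(ℝ, E) x₀).source := by simpa using h₀
  rw [← contMDiffAt_iff_contDiffAt]
  refine ContMDiffAt.comp_of_eq (y := y) (x := extChartAt 𝓘(ℝ, E) x₀ y)
    (contMDiffAt_extChartAt' h₁) ?_ ((extChartAt 𝓘(ℝ, E) x₀).left_inv h0')
  exact (contMDiffOn_extChartAt_symm (I := 𝓘(ℝ, E)) (n := ∞) x₀).contMDiffAt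
    ((isOpen_extChartAt_target x₀).mem_nhds ((extChartAt 𝓘(ℝ, E) x₀).map_source h0'))

omit [IsManifold 𝓘(ℝ, E) ∞ M] in
/-- The points of the chart at `x₀` near `φ₀ y` come from points in both chart domains. -/
theorem eventually_mem_source {x₀ x₁ y : M} (h₀ : y ∈ (chartAt E x₀).source)
    (h₁ : y ∈ (chartAt E x₁).source) : ∀ᶠ q in 𝓝 (extChartAt 𝓘(ℝ, E) x₀ y),
      ∃ y' : M, y' ∈ (chartAt E x₀).source ∧ y' ∈ (chartAt E x₁).source ∧
        extChartAt 𝓘(ℝ, E) x₀ y' = q := by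
  have h0' : y ∈ (extChartAt 𝓘(ℝ, E) x₀).source := by simpa using h₀
  have ht := (extChartAt 𝓘(ℝ, E) x₀).map_source h0'
  have hc : ContinuousAt (extChartAt 𝓘(ℝ, E) x₀).symm (extChartAt 𝓘(ℝ, E) x₀ y) :=
    continuousAt_extChartAt_symm' h0'
  have hev := hc.eventually_mem (s := (chartAt E x₁).source) (by
    rw [(extChartAt 𝓘(ℝ, E) x₀).left_inv h0']
    exact (chartAt E x₁).open_source.mem_nhds h₁)
  filter_upwards [hev, (isOpen_extChartAt_target x₀).mem_nhds ht] with q hq hqt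
  exact ⟨_, by simpa using (extChartAt 𝓘(ℝ, E) x₀).map_target hqt, hq,
    (extChartAt 𝓘(ℝ, E) x₀).right_inv hqt⟩

/-- The chain rule for `φ₁⁻¹ ∘ (φ₁ ∘ φ₀⁻¹) = φ₀⁻¹`. -/
theorem mfderiv_symm_chartTransition {x₀ x₁ y : M} (h₀ : y ∈ (chartAt E x₀).source)
    (h₁ : y ∈ (chartAt E x₁).source) (u : E) :
    (mfderiv 𝓘(ℝ, E) 𝓘(ℝ, E) (extChartAt 𝓘(ℝ, E) x₁).symm (extChartAt 𝓘(ℝ, E) x₁ y)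
        (fderiv ℝ (chartTransition x₀ x₁) (extChartAt 𝓘(ℝ, E) x₀ y) u : E) : E) =
      (mfderiv 𝓘(ℝ, E) 𝓘(ℝ, E) (extChartAt 𝓘(ℝ, E) x₀).symm (extChartAt 𝓘(ℝ, E) x₀ y) u : E) := by
  have h1' : y ∈ (extChartAt 𝓘(ℝ, E) x₁).source := by simpa using h₁
  have ht := (extChartAt 𝓘(ℝ, E) x₁).map_source h1'
  have e : (extChartAt 𝓘(ℝ, E) x₁).symm ∘ chartTransition x₀ x₁
      =ᶠ[𝓝 (extChartAt 𝓘(ℝ, E) x₀ y)] (extChartAt 𝓘(ℝ, E) x₀).symm := by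
    filter_upwards [eventually_mem_source h₀ h₁] with q hq
    obtain ⟨y', h0, h1, rfl⟩ := hq
    simp only [Function.comp_apply, chartTransition]
    rw [(extChartAt 𝓘(ℝ, E) x₀).left_inv (by simpa using h0),
      (extChartAt 𝓘(ℝ, E) x₁).left_inv (by simpa using h1)]
  have hm : MDifferentiableAt 𝓘(ℝ, E) 𝓘(ℝ, E) (extChartAt 𝓘(ℝ, E) x₁).symm
      (extChartAt 𝓘(ℝ, E) x₁ y) :=
    ((contMDiffOn_extChartAt_symm (I := 𝓘(ℝ, E)) (n := ∞) x₁).contMDiffAt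
      ((isOpen_extChartAt_target x₁).mem_nhds ht)).mdifferentiableAt (by simp)
  have hd : MDifferentiableAt 𝓘(ℝ, E) 𝓘(ℝ, E) (chartTransition x₀ x₁)
      (extChartAt 𝓘(ℝ, E) x₀ y) :=
    ((contDiffAt_chartTransition h₀ h₁).differentiableAt (by simp)).mdifferentiableAt
  have hc := mfderiv_comp_of_eq hm hd (chartTransition_extChartAt h₀)
  rw [← e.mfderiv_eq, hc, chartTransition_extChartAt h₀, mfderiv_eq_fderiv]
  rfl

theorem fderiv_chartTransition_comp {x₀ x₁ y : M} (h₀ : y ∈ (chartAt E x₀).source)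
    (h₁ : y ∈ (chartAt E x₁).source) (u : E) :
    fderiv ℝ (chartTransition x₀ x₁) (extChartAt 𝓘(ℝ, E) x₀ y)
      (fderiv ℝ (chartTransition x₁ x₀) (extChartAt 𝓘(ℝ, E) x₁ y) u) = u := by
  apply (isInvertible_mfderiv_extChartAt_symm (x₀ := x₁) (q := extChartAt 𝓘(ℝ, E) x₁ y)
    ((extChartAt 𝓘(ℝ, E) x₁).map_source (by simpa using h₁))).injective
  exact (mfderiv_symm_chartTransition h₀ h₁ _).trans (mfderiv_symm_chartTransition h₁ h₀ _)

theorem chartMetric_chartTransition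
    (g : ContMDiffRiemannianMetric 𝓘(ℝ, E) ∞ E (fun x : M ↦ TangentSpace 𝓘(ℝ, E) x))
    {x₀ x₁ y : M} (h₀ : y ∈ (chartAt E x₀).source) (h₁ : y ∈ (chartAt E x₁).source) (u v : E) :
    chartMetric g x₀ (extChartAt 𝓘(ℝ, E) x₀ y) u v =
      chartMetric g x₁ (chartTransition x₀ x₁ (extChartAt 𝓘(ℝ, E) x₀ y))
        (fderiv ℝ (chartTransition x₀ x₁) (extChartAt 𝓘(ℝ, E) x₀ y) u)
        (fderiv ℝ (chartTransition x₀ x₁) (extChartAt 𝓘(ℝ, E) x₀ y) v) := by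
  rw [chartTransition_extChartAt h₀,
    chartMetric_apply g ((extChartAt 𝓘(ℝ, E) x₀).left_inv (by simpa using h₀)),
    chartMetric_apply g ((extChartAt 𝓘(ℝ, E) x₁).left_inv (by simpa using h₁)),
    mfderiv_symm_chartTransition h₀ h₁, mfderiv_symm_chartTransition h₀ h₁]

/-- The change of coordinates on `T*M` induced by a change of coordinates on `M`. -/
theorem extChartAt_cotangent_eq (p p' w : CotangentBundle E M)
    (h₀ : w.proj ∈ (chartAt E p.proj).source) (h₁ : w.proj ∈ (chartAt E p'.proj).source) :
    extChartAt (cotangentModel E) p w =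
      (fun z : E × (E →L[ℝ] ℝ) ↦ (chartTransition p'.proj p.proj z.1,
        z.2 ∘L fderiv ℝ (chartTransition p.proj p'.proj) (chartTransition p'.proj p.proj z.1)))
        (extChartAt (cotangentModel E) p' w) := by
  rw [extChartAt_cotangent_apply p w h₀, extChartAt_cotangent_apply p' w h₁]
  simp only [chartTransition_extChartAt h₁]
  refine Prod.ext rfl ?_
  ext u
  exact congrArg w.2 (mfderiv_symm_chartTransition h₀ h₁ u).symm

theorem mem_extChartAt_cotangent_source {p w : CotangentBundle E M} :
    w ∈ (extChartAt (cotangentModel E) p).source ↔ w.proj ∈ (chartAt E p.proj).source := by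
  rw [FiberBundle.extChartAt]
  suffices w.proj ∈ (chartAt E p.proj).source →
      (trivializationAt (E →L[ℝ] ℝ)
        (fun x : M ↦ TangentSpace 𝓘(ℝ, E) x →L[ℝ] Bundle.Trivial M ℝ x) p.proj w).1 ∈
        (chartAt E p.proj).source by simpa using this
  intro h
  rw [Trivialization.coe_fst' _ (by simpa using h)]
  exact h

/-- The differential at `w` of the chart of `T*M` at `p`. -/
def chartDeriv (p w : CotangentBundle E M) :
    TangentSpace (cotangentModel E) w →L[ℝ] E × (E →L[ℝ] ℝ) :=
  mfderiv (cotangentModel E) 𝓘(ℝ, E × (E →L[ℝ] ℝ)) (extChartAt (cotangentModel E) p) w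

theorem isInvertible_chartDeriv {p w : CotangentBundle E M}
    (hw : w ∈ (extChartAt (cotangentModel E) p).source) : (chartDeriv p w).IsInvertible :=
  isInvertible_mfderiv_extChartAt hw

theorem naturalDiagonalLift_apply
    (g : ContMDiffRiemannianMetric 𝓘(ℝ, E) ∞ E (fun x : M ↦ TangentSpace 𝓘(ℝ, E) x))
    (a₁ b₁ a₂ b₂ : ℝ → ℝ) (p : CotangentBundle E M) (v : TangentSpace (cotangentModel E) p) :
    naturalDiagonalLift g a₁ b₁ a₂ b₂ p v = (chartDeriv p p).inverse
      (localP (chartMetric g p.proj) a₁ b₁ a₂ b₂ (extChartAt (cotangentModel E) p p)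
        (chartDeriv p p v)) := rfl

variable [FiniteDimensional ℝ E]

/-- Near a point, the natural diagonal lift is given by the same coordinate formula in the chart of
`T*M` at that point. -/
theorem chartDeriv_naturalDiagonalLift
    (g : ContMDiffRiemannianMetric 𝓘(ℝ, E) ∞ E (fun x : M ↦ TangentSpace 𝓘(ℝ, E) x))
    (a₁ b₁ a₂ b₂ : ℝ → ℝ) (p w : CotangentBundle E M)
    (h₀ : w.proj ∈ (chartAt E p.proj).source) (v : TangentSpace (cotangentModel E) w) :
    chartDeriv p w (naturalDiagonalLift g a₁ b₁ a₂ b₂ w v) =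
      localP (chartMetric g p.proj) a₁ b₁ a₂ b₂ (extChartAt (cotangentModel E) p w)
        (chartDeriv p w v) := by
  have h₁ : w.proj ∈ (chartAt E w.proj).source := mem_chart_source E w.proj
  set Ψ := fun z : E × (E →L[ℝ] ℝ) ↦ (chartTransition w.proj p.proj z.1,
        z.2 ∘L fderiv ℝ (chartTransition p.proj w.proj) (chartTransition w.proj p.proj z.1)) with hΨ
  have hk : chartTransition w.proj p.proj (extChartAt 𝓘(ℝ, E) w.proj w.proj) =
    extChartAt 𝓘(ℝ, E) p.proj w.proj := chartTransition_extChartAt h₁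
  have hkd := ((contDiffAt_chartTransition h₁ h₀).differentiableAt (by simp)).hasFDerivAt
  have hhd := contDiffAt_chartTransition h₀ h₁
  obtain ⟨ξ, hξ⟩ : ∃ ξ, extChartAt (cotangentModel E) w w =
      (extChartAt 𝓘(ℝ, E) w.proj w.proj, ξ) := ⟨_, extChartAt_cotangent_apply w w h₁⟩
  have hev : extChartAt (cotangentModel E) p =ᶠ[𝓝 w] Ψ ∘ extChartAt (cotangentModel E) w := by
    have hc : ContinuousAt (TotalSpace.proj : CotangentBundle E M → M) w :=
      (FiberBundle.continuous_proj _ _).continuousAt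
    filter_upwards [hc.eventually_mem ((chartAt E p.proj).open_source.mem_nhds h₀),
      hc.eventually_mem ((chartAt E w.proj).open_source.mem_nhds h₁)] with w' h0 h1
    exact extChartAt_cotangent_eq p w w' h0 h1
  have hΨd : DifferentiableAt ℝ Ψ (extChartAt (cotangentModel E) w w) := by
    rw [hξ]
    exact (hasFDerivAt_covector_change (hk.symm ▸ hhd) hkd ξ).differentiableAt
  have hD (v : TangentSpace (cotangentModel E) w) :
      chartDeriv p w v = fderiv ℝ Ψ (extChartAt (cotangentModel E) w w) (chartDeriv w w v) := by
    rw [chartDeriv, hev.mfderiv_eq, mfderiv_comp w hΨd.mdifferentiableAt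
      (mdifferentiableAt_extChartAt (mem_chart_source _ w)), mfderiv_eq_fderiv]
    rfl
  rw [hD, hD, hev.self_of_nhds, Function.comp_apply]
  rw [naturalDiagonalLift_apply,
    (isInvertible_chartDeriv (mem_extChartAt_source w)).self_apply_inverse, hξ]
  symm
  refine localP_change_coordinates (U₀ := (extChartAt 𝓘(ℝ, E) p.proj).target)
    (U₁ := (extChartAt 𝓘(ℝ, E) w.proj).target) (k := chartTransition w.proj p.proj)
    (isMetricOn_chartMetric g p.proj) (isMetricOn_chartMetric g w.proj) ?_
    (mem_extChartAt_target w.proj) ?_ (hk.symm ▸ hhd) hkd ?_ ?_ ξ _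
  · rw [hk]
    exact (extChartAt 𝓘(ℝ, E) p.proj).map_source (by simpa using h₀)
  · rw [hk, chartTransition_extChartAt h₀]
  · rw [hk]
    filter_upwards [eventually_mem_source h₀ h₁] with q hq
    obtain ⟨y', h0, h1, rfl⟩ := hq
    exact chartMetric_chartTransition g h0 h1
  · rw [hk]
    exact fderiv_chartTransition_comp h₀ h₁

end ChartInvariance

/-! ### The Nijenhuis tensor in coordinates -/

section Nijenhuis

section Vector

variable {F : Type*} [NormedAddCommGroup F] [NormedSpace ℝ F]

/-- The value at `y` of the Nijenhuis tensor of the field `Q` of endomorphisms of a vector space,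
on vectors `u` and `v`, i.e. on the constant vector fields `u` and `v`. -/
def nijenhuisForm (Q : F → F →L[ℝ] F) (y u v : F) : F :=
  fderiv ℝ Q y (Q y u) v - fderiv ℝ Q y (Q y v) u + Q y (fderiv ℝ Q y v u)
    - Q y (fderiv ℝ Q y u v)

/-- The Nijenhuis tensor is a tensor: it only depends on the values of the vector fields. -/
theorem nijenhuisForm_eq_lieBracket {Q : F → F →L[ℝ] F} {X Y : F → F} {y : F}
    (hQ : DifferentiableAt ℝ Q y) (hX : DifferentiableAt ℝ X y) (hY : DifferentiableAt ℝ Y y) :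
    VectorField.lieBracket ℝ (fun z ↦ Q z (X z)) (fun z ↦ Q z (Y z)) y
      - Q y (VectorField.lieBracket ℝ (fun z ↦ Q z (X z)) Y y)
      - Q y (VectorField.lieBracket ℝ X (fun z ↦ Q z (Y z)) y)
      + Q y (Q y (VectorField.lieBracket ℝ X Y y)) = nijenhuisForm Q y (X y) (Y y) := by
  simp only [VectorField.lieBracket, fderiv_clm_apply hQ hX, fderiv_clm_apply hQ hY, nijenhuisForm]
  simp
  abel

theorem nijenhuisForm_swap (Q : F → F →L[ℝ] F) (y u v : F) :
    nijenhuisForm Q y v u = -nijenhuisForm Q y u v := by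
  simp only [nijenhuisForm]
  abel

theorem nijenhuisForm_add_left (Q : F → F →L[ℝ] F) (y u u' v : F) :
    nijenhuisForm Q y (u + u') v = nijenhuisForm Q y u v + nijenhuisForm Q y u' v := by
  simp only [nijenhuisForm, map_add, add_apply]
  abel

/-- If `Q² = I` near `y`, the Nijenhuis tensor satisfies `N(Q u, v) = -Q N(u, v)`; this follows by
differentiating `Q² = I`. -/
theorem nijenhuisForm_apply_left {Q : F → F →L[ℝ] F} {y : F} (hQ : DifferentiableAt ℝ Q y)
    (hQ2 : ∀ᶠ z in 𝓝 y, ∀ v, Q z (Q z v) = v) (u v : F) :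
    nijenhuisForm Q y (Q y u) v = -Q y (nijenhuisForm Q y u v) := by
  have h (w v : F) : fderiv ℝ Q y w (Q y v) = -Q y (fderiv ℝ Q y w v) := by
    have h1 := (hQ.hasFDerivAt.clm_apply
      (hQ.hasFDerivAt.clm_apply (hasFDerivAt_const v y))).fderiv
    have h2 : (fun z ↦ Q z (Q z v)) =ᶠ[𝓝 y] fun _ ↦ v := hQ2.mono fun z hz ↦ hz v
    rw [h2.fderiv_eq] at h1
    have h3 := DFunLike.congr_fun h1 w
    simp at h3
    exact eq_neg_of_add_eq_zero_right h3.symm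
  simp only [nijenhuisForm, h, hQ2.self_of_nhds, map_add, map_sub, map_neg]
  abel

end Vector

variable {E : Type*} [NormedAddCommGroup E] [NormedSpace ℝ E]
  {M : Type*} [TopologicalSpace M] [ChartedSpace E M] [IsManifold 𝓘(ℝ, E) ∞ M]

/-- The coordinate expression of a vector field in the chart of `T*M` at `p`. -/
def localField (X : (p : CotangentBundle E M) → TangentSpace (cotangentModel E) p)
    (p : CotangentBundle E M) (y : E × (E →L[ℝ] ℝ)) : E × (E →L[ℝ] ℝ) :=
  chartDeriv p ((extChartAt (cotangentModel E) p).symm y)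
    (X ((extChartAt (cotangentModel E) p).symm y))

theorem mpullbackWithin_eq_localField
    (X : (p : CotangentBundle E M) → TangentSpace (cotangentModel E) p)
    {p : CotangentBundle E M} {y : E × (E →L[ℝ] ℝ)}
    (hy : y ∈ (extChartAt (cotangentModel E) p).target) :
    VectorField.mpullbackWithin 𝓘(ℝ, E × (E →L[ℝ] ℝ)) (cotangentModel E)
      (extChartAt (cotangentModel E) p).symm X (range (cotangentModel E)) y = localField X p y := by
  refine (isInvertible_mfderivWithin_extChartAt_symm hy).inverse_apply_eq.2 ?_
  exact (DFunLike.congr_fun (mfderivWithin_extChartAt_symm_comp_mfderiv_extChartAt hy) _).symm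

theorem eventuallyEq_localField
    (X : (p : CotangentBundle E M) → TangentSpace (cotangentModel E) p)
    (p : CotangentBundle E M) :
    VectorField.mpullbackWithin 𝓘(ℝ, E × (E →L[ℝ] ℝ)) (cotangentModel E)
      (extChartAt (cotangentModel E) p).symm X (range (cotangentModel E))
      =ᶠ[𝓝 (extChartAt (cotangentModel E) p p)] localField X p := by
  filter_upwards [extChartAt_target_mem_nhds (I := cotangentModel E) p] with y hy
  exact mpullbackWithin_eq_localField X hy

theorem mlieBracket_eq_lieBracket_localField
    (X Y : (p : CotangentBundle E M) → TangentSpace (cotangentModel E) p)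
    (p : CotangentBundle E M) :
    VectorField.mlieBracket (cotangentModel E) X Y p =
      (chartDeriv p p).inverse (VectorField.lieBracket ℝ (localField X p) (localField Y p)
          (extChartAt (cotangentModel E) p p)) := by
  rw [← VectorField.mlieBracketWithin_univ, VectorField.mlieBracketWithin_apply]
  have hu : (extChartAt (cotangentModel E) p).symm ⁻¹' univ ∩ range (cotangentModel E) = univ := by
    rw [preimage_univ, univ_inter, ModelWithCorners.range_eq_univ]
  rw [hu]
  refine congrArg (chartDeriv p p).inverse
    ((congrFun VectorField.lieBracketWithin_univ _).trans ?_)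
  exact (eventuallyEq_localField X p).lieBracket_vectorField_eq (eventuallyEq_localField Y p)

theorem differentiableAt_localField [CompleteSpace E]
    {X : (p : CotangentBundle E M) → TangentSpace (cotangentModel E) p} {p : CotangentBundle E M}
    (hX : ContMDiffAt (cotangentModel E) (cotangentModel E).tangent ∞
      (fun z ↦ (⟨z, X z⟩ : TangentBundle (cotangentModel E) (CotangentBundle E M))) p) :
    DifferentiableAt ℝ (localField X p) (extChartAt (cotangentModel E) p p) := by
  have h1 := (mdifferentiableWithinAt_univ.2
    (hX.mdifferentiableAt (by simp))).differentiableWithinAt_mpullbackWithin_vectorField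
  have : range (cotangentModel E) = univ := ModelWithCorners.range_eq_univ _
  rw [preimage_univ, univ_inter] at h1
  have h2 : DifferentiableAt ℝ (F := E × (E →L[ℝ] ℝ)) (VectorField.mpullbackWithin
      𝓘(ℝ, E × (E →L[ℝ] ℝ)) (cotangentModel E) (extChartAt (cotangentModel E) p).symm X
      (range (cotangentModel E))) (extChartAt (cotangentModel E) p p) :=
    h1.differentiableAt (this ▸ Filter.univ_mem)
  exact h2.congr_of_eventuallyEq (eventuallyEq_localField X p).symm

/-- The Nijenhuis tensor of a field of endomorphisms of `T*M` vanishes iff that of its coordinate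
expression in the chart at `p` vanishes at `p`, for all `p`. -/
theorem isIntegrable_iff_nijenhuisForm [CompleteSpace E] {P : EndField E M}
    {Q : CotangentBundle E M → (E × (E →L[ℝ] ℝ)) → (E × (E →L[ℝ] ℝ)) →L[ℝ] (E × (E →L[ℝ] ℝ))}
    (hQ : ∀ p, DifferentiableAt ℝ (Q p) (extChartAt (cotangentModel E) p p))
    (hPQ : ∀ p w : CotangentBundle E M, w ∈ (extChartAt (cotangentModel E) p).source → ∀ v,
      chartDeriv p w (P w v) = Q p (extChartAt (cotangentModel E) p w) (chartDeriv p w v)) :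
    IsIntegrable P ↔ ∀ p u v, nijenhuisForm (Q p) (extChartAt (cotangentModel E) p p) u v = 0 := by
  have hinv (p : CotangentBundle E M) : (chartDeriv p p).IsInvertible :=
    isInvertible_chartDeriv (mem_extChartAt_source p)
  have hfield (X : (p : CotangentBundle E M) → TangentSpace (cotangentModel E) p)
      (p : CotangentBundle E M) : localField (fun z ↦ P z (X z)) p
        =ᶠ[𝓝 (extChartAt (cotangentModel E) p p)] fun y ↦ Q p y (localField X p y) := by
    filter_upwards [extChartAt_target_mem_nhds (I := cotangentModel E) p] with y hy
    rw [localField, hPQ p _ ((extChartAt (cotangentModel E) p).map_target hy),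
      (extChartAt (cotangentModel E) p).right_inv hy]
    rfl
  have hDP (p : CotangentBundle E M) (v : E × (E →L[ℝ] ℝ)) :
      P p ((chartDeriv p p).inverse v) =
        (chartDeriv p p).inverse (Q p (extChartAt (cotangentModel E) p p) v) := by
    symm
    rw [(hinv p).inverse_apply_eq, hPQ p p (mem_extChartAt_source p), (hinv p).self_apply_inverse]
  have key (X Y : (p : CotangentBundle E M) → TangentSpace (cotangentModel E) p)
      (p : CotangentBundle E M)
      (hX : ContMDiffAt (cotangentModel E) (cotangentModel E).tangent ∞
        (fun z ↦ (⟨z, X z⟩ : TangentBundle (cotangentModel E) (CotangentBundle E M))) p)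
      (hY : ContMDiffAt (cotangentModel E) (cotangentModel E).tangent ∞
        (fun z ↦ (⟨z, Y z⟩ : TangentBundle (cotangentModel E) (CotangentBundle E M))) p) :
      nijenhuis P X Y p = (chartDeriv p p).inverse
        (nijenhuisForm (Q p) (extChartAt (cotangentModel E) p p)
          (localField X p (extChartAt (cotangentModel E) p p))
          (localField Y p (extChartAt (cotangentModel E) p p))) := by
    rw [← nijenhuisForm_eq_lieBracket (hQ p) (differentiableAt_localField hX)
      (differentiableAt_localField hY), nijenhuis]
    simp only [mlieBracket_eq_lieBracket_localField, hDP]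
    rw [(hfield X p).lieBracket_vectorField_eq (hfield Y p),
      (hfield X p).lieBracket_vectorField_eq (Filter.EventuallyEq.refl _ (localField Y p)),
      (Filter.EventuallyEq.refl _ (localField X p)).lieBracket_vectorField_eq (hfield Y p)]
    simp only [map_add, map_sub]
  have hvec (p : CotangentBundle E M) (u : E × (E →L[ℝ] ℝ)) :
      ∃ X : (p : CotangentBundle E M) → TangentSpace (cotangentModel E) p,
        ContMDiffAt (cotangentModel E) (cotangentModel E).tangent ∞
          (fun z ↦ (⟨z, X z⟩ : TangentBundle (cotangentModel E) (CotangentBundle E M))) p ∧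
        localField X p (extChartAt (cotangentModel E) p p) = u := by
    refine ⟨FiberBundle.extend (E × (E →L[ℝ] ℝ)) ((chartDeriv p p).inverse u),
      FiberBundle.contMDiffAt_extend _ _ _, ?_⟩
    rw [localField, extChartAt_to_inv, FiberBundle.extend_apply_self]
    exact (hinv p).self_apply_inverse u
  constructor
  · intro h p u v
    obtain ⟨X, hX, rfl⟩ := hvec p u
    obtain ⟨Y, hY, rfl⟩ := hvec p v
    have h1 := h X Y p hX hY
    rw [key X Y p hX hY] at h1
    exact (hinv p).inverse.injective (h1.trans (map_zero _).symm)
  · intro h X Y p hX hY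
    rw [key X Y p hX hY, h]
    exact map_zero _

end Nijenhuis

/-! ### Derivatives of the lifted tensors -/

section LocalDerivatives

variable {E : Type*} [NormedAddCommGroup E] [NormedSpace ℝ E] [FiniteDimensional ℝ E]
variable {G : E → E →L[ℝ] E →L[ℝ] ℝ} {U : Set E} {a b a₁ b₁ a₂ b₂ : ℝ → ℝ}
  {z : E × (E →L[ℝ] ℝ)}

namespace IsMetricOn

theorem energy_nonneg (hG : IsMetricOn G U) (hz : z.1 ∈ U) : 0 ≤ energy G z := by
  rw [energy]
  nth_rw 1 [← hG.apply_sharp hz z.2]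
  rcases eq_or_ne (sharp G z.1 z.2) 0 with h | h
  · simp [h]
  · have := hG.pos z.1 hz _ h
    positivity

omit [FiniteDimensional ℝ E] in
theorem eventually_fst_mem (hG : IsMetricOn G U) (hz : z.1 ∈ U) :
    ∀ᶠ y : E × (E →L[ℝ] ℝ) in 𝓝 z, y.1 ∈ U :=
  continuousAt_fst.eventually_mem (hG.isOpen.mem_nhds hz)

theorem contDiffAt_sharp_fst (hG : IsMetricOn G U) (hz : z.1 ∈ U) :
    ContDiffAt ℝ ∞ (fun y : E × (E →L[ℝ] ℝ) ↦ sharp G y.1) z :=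
  (hG.contDiffAt_sharp hz).comp z contDiffAt_fst

theorem contDiffAt_energy (hG : IsMetricOn G U) (hz : z.1 ∈ U) : ContDiffAt ℝ ∞ (energy G) z :=
  contDiffAt_const.mul
    (contDiffAt_snd.clm_apply ((hG.contDiffAt_sharp_fst hz).clm_apply contDiffAt_snd))

theorem contDiffAt_comp_energy (hG : IsMetricOn G U) (hz : z.1 ∈ U)
    (ha : ContDiffOn ℝ ∞ a (Ici 0)) : ContDiffAt ℝ ∞ (fun y ↦ a (energy G y)) z := by
  have h1 : ContDiffWithinAt ℝ ∞ (fun y ↦ a (energy G y)) {y | y.1 ∈ U} z :=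
    (ha _ (hG.energy_nonneg hz)).comp z (hG.contDiffAt_energy hz).contDiffWithinAt
      fun y hy ↦ hG.energy_nonneg hy
  exact h1.contDiffAt (hG.eventually_fst_mem hz)

/-- The differential of the energy density only sees the vertical part of a vector. -/
theorem fderiv_energy (hG : IsMetricOn G U) (hz : z.1 ∈ U) (w : E × (E →L[ℝ] ℝ)) :
    fderiv ℝ (energy G) z w = verticalPart G z w (sharp G z.1 z.2) := by
  have hs : HasFDerivAt (fun y : E × (E →L[ℝ] ℝ) ↦ sharp G y.1 y.2)
      (fderiv ℝ (fun y : E × (E →L[ℝ] ℝ) ↦ sharp G y.1 y.2) z) z :=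
    (((hG.contDiffAt_sharp_fst hz).clm_apply contDiffAt_snd).differentiableAt
      (by simp)).hasFDerivAt
  set s := sharp G z.1 z.2 with hsdef
  set s' := fderiv ℝ (fun y : E × (E →L[ℝ] ℝ) ↦ sharp G y.1 y.2) z with hs'
  have hGd : HasFDerivAt (fun y : E × (E →L[ℝ] ℝ) ↦ G y.1)
      (fderiv ℝ G z.1 ∘L ContinuousLinearMap.fst ℝ E (E →L[ℝ] ℝ)) z :=
    (hG.differentiableAt hz).hasFDerivAt.comp z hasFDerivAt_fst
  -- Differentiate `G (♯ ξ) = ξ`.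
  have h1 : G z.1 (s' w) + fderiv ℝ G z.1 w.1 s = w.2 := by
    have e : (fun y : E × (E →L[ℝ] ℝ) ↦ G y.1 (sharp G y.1 y.2)) =ᶠ[𝓝 z] Prod.snd :=
      (hG.eventually_fst_mem hz).mono fun y hy ↦ hG.apply_sharp hy y.2
    have := ((hGd.clm_apply hs).congr_of_eventuallyEq e.symm).unique hasFDerivAt_snd
    simpa using DFunLike.congr_fun this w
  have h2 : fderiv ℝ (energy G) z w = (1 / 2) * (w.2 s + z.2 (s' w)) := by
    have := ((hasFDerivAt_snd.clm_apply hs).const_mul (1 / 2 : ℝ)).fderiv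
    have e := DFunLike.congr_fun this w
    refine e.trans ?_
    simp
    ring
  have h3 : z.2 (s' w) = G z.1 (s' w) s := by
    rw [hG.symm _ hz, hsdef, hG.apply_sharp hz]
  have h4 : G z.1 (s' w) s = w.2 s - fderiv ℝ G z.1 w.1 s s := by
    rw [← h1]; simp
  have h5 : G z.1 (christoffel G z.1 w.1 s) s = z.2 (christoffel G z.1 w.1 s) := by
    rw [hG.symm _ hz, hsdef, hG.apply_sharp hz]
  have h6 : G z.1 s (christoffel G z.1 w.1 s) = z.2 (christoffel G z.1 w.1 s) := by
    rw [hsdef, hG.apply_sharp hz]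
  have h7 : verticalPart G z w s = w.2 s - z.2 (christoffel G z.1 w.1 s) := rfl
  rw [h2, h3, h4, h7, hG.fderiv_apply hz, h5, h6]
  ring

theorem hasFDerivAt_comp_energy (hG : IsMetricOn G U) (hz : z.1 ∈ U)
    (ha : ContDiffOn ℝ ∞ a (Ici 0)) : HasFDerivAt (fun y ↦ a (energy G y))
      (derivWithin a (Ici 0) (energy G z) • fderiv ℝ (energy G) z) z := by
  have h1 : HasDerivWithinAt a (derivWithin a (Ici 0) (energy G z)) (Ici 0) (energy G z) :=
    ((ha _ (hG.energy_nonneg hz)).differentiableWithinAt (by simp)).hasDerivWithinAt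
  have h2 := h1.comp_hasFDerivWithinAt z (s := {y : E × (E →L[ℝ] ℝ) | y.1 ∈ U})
    ((hG.contDiffAt_energy hz).differentiableAt (by simp)).hasFDerivAt.hasFDerivWithinAt
      fun _ hy ↦ hG.energy_nonneg hy
  exact h2.hasFDerivAt (hG.eventually_fst_mem hz)

theorem contDiffAt_lowerTensor (hG : IsMetricOn G U) (hz : z.1 ∈ U)
    (ha : ContDiffOn ℝ ∞ a (Ici 0)) (hb : ContDiffOn ℝ ∞ b (Ici 0)) :
    ContDiffAt ℝ ∞ (lowerTensor G a b) z :=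
  ((hG.contDiffAt_comp_energy hz ha).smul ((hG.contDiffAt hz).comp z contDiffAt_fst)).add
    ((hG.contDiffAt_comp_energy hz hb).smul (contDiffAt_snd.smulRight contDiffAt_snd))

theorem contDiffAt_upperTensor (hG : IsMetricOn G U) (hz : z.1 ∈ U)
    (ha : ContDiffOn ℝ ∞ a (Ici 0)) (hb : ContDiffOn ℝ ∞ b (Ici 0)) :
    ContDiffAt ℝ ∞ (upperTensor G a b) z :=
  ((hG.contDiffAt_comp_energy hz ha).smul (hG.contDiffAt_sharp_fst hz)).add
    ((hG.contDiffAt_comp_energy hz hb).smul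
      ((contDiffAt_snd.clm_comp (hG.contDiffAt_sharp_fst hz)).smulRight
        ((hG.contDiffAt_sharp_fst hz).clm_apply contDiffAt_snd)))

theorem contDiffAt_gammaZero (hG : IsMetricOn G U) (hz : z.1 ∈ U) :
    ContDiffAt ℝ ∞ (gammaZero G) z :=
  ((ContinuousLinearMap.compL ℝ E E ℝ).contDiff.contDiffAt.comp z contDiffAt_snd).clm_comp
    ((hG.contDiffAt_christoffel hz).comp z contDiffAt_fst)

theorem contDiffAt_localP (hG : IsMetricOn G U) (hz : z.1 ∈ U)
    (ha₁ : ContDiffOn ℝ ∞ a₁ (Ici 0)) (hb₁ : ContDiffOn ℝ ∞ b₁ (Ici 0))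
    (ha₂ : ContDiffOn ℝ ∞ a₂ (Ici 0)) (hb₂ : ContDiffOn ℝ ∞ b₂ (Ici 0)) :
    ContDiffAt ℝ ∞ (localP G a₁ b₁ a₂ b₂) z := by
  have hγ := hG.contDiffAt_gammaZero hz
  have hH : ContDiffAt ℝ ∞ (horizontalLift G) z :=
    (ContinuousLinearMap.prodₗᵢ (𝕜 := ℝ) (E := E) (F := E)
      (G := E →L[ℝ] ℝ) ℝ).contDiff.contDiffAt.comp z (contDiffAt_const.prodMk hγ)
  have hV : ContDiffAt ℝ ∞ (verticalPart G) z :=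
    contDiffAt_const.sub (hγ.clm_comp contDiffAt_const)
  exact (contDiffAt_const.clm_comp
      ((hG.contDiffAt_lowerTensor hz ha₁ hb₁).clm_comp contDiffAt_const)).add
    (hH.clm_comp ((hG.contDiffAt_upperTensor hz ha₂ hb₂).clm_comp hV))

/-- The derivative of the tensor `a g_ij + b p_i p_j`. On a horizontal vector only the terms with
Christoffel symbols remain: the tensor is parallel in horizontal directions. -/
theorem fderiv_lowerTensor (hG : IsMetricOn G U) (hz : z.1 ∈ U)
    (ha : ContDiffOn ℝ ∞ a (Ici 0)) (hb : ContDiffOn ℝ ∞ b (Ici 0)) (w : E × (E →L[ℝ] ℝ))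
    (u v : E) : fderiv ℝ (fun y ↦ lowerTensor G a b y u) z w v =
      lowerTensor G a b z (christoffel G z.1 w.1 u) v
        + lowerTensor G a b z u (christoffel G z.1 w.1 v)
        + derivWithin a (Ici 0) (energy G z) * verticalPart G z w (sharp G z.1 z.2) * G z.1 u v
        + derivWithin b (Ici 0) (energy G z) * verticalPart G z w (sharp G z.1 z.2)
          * (z.2 u * z.2 v)
        + b (energy G z) * (verticalPart G z w u * z.2 v + z.2 u * verticalPart G z w v) := by
  have h0 : DifferentiableAt ℝ (fun y ↦ lowerTensor G a b y u) z :=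
    ((hG.contDiffAt_lowerTensor hz ha hb).clm_apply contDiffAt_const).differentiableAt (by simp)
  have h1 := (h0.hasFDerivAt.clm_apply (hasFDerivAt_const v z)).fderiv
  have hGd : HasFDerivAt (fun y : E × (E →L[ℝ] ℝ) ↦ G y.1)
      (fderiv ℝ G z.1 ∘L ContinuousLinearMap.fst ℝ E (E →L[ℝ] ℝ)) z :=
    (hG.differentiableAt hz).hasFDerivAt.comp z hasFDerivAt_fst
  have hξ (u : E) := (hasFDerivAt_snd (𝕜 := ℝ) (p := z)).clm_apply (hasFDerivAt_const u z)
  have h2 := (((hG.hasFDerivAt_comp_energy hz ha).mul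
    ((hGd.clm_apply (hasFDerivAt_const u z)).clm_apply (hasFDerivAt_const v z))).add
    ((hG.hasFDerivAt_comp_energy hz hb).mul ((hξ u).mul (hξ v)))).fderiv
  have h3 := DFunLike.congr_fun (h1.symm.trans h2) w
  have h4 (x : E) : verticalPart G z w x = w.2 x - z.2 (christoffel G z.1 w.1 x) := rfl
  simp [hG.fderiv_energy hz, hG.fderiv_apply hz] at h3
  rw [h3]
  simp only [lowerTensor_apply, h4]
  ring

theorem fderiv_gammaZero (hG : IsMetricOn G U) (hz : z.1 ∈ U) (w : E × (E →L[ℝ] ℝ)) (u v : E) :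
    fderiv ℝ (fun y ↦ gammaZero G y u) z w v =
      w.2 (christoffel G z.1 u v) + z.2 (fderiv ℝ (christoffel G) z.1 w.1 u v) := by
  have h0 : DifferentiableAt ℝ (fun y ↦ gammaZero G y u) z :=
    ((hG.contDiffAt_gammaZero hz).clm_apply contDiffAt_const).differentiableAt (by simp)
  have h1 := (h0.hasFDerivAt.clm_apply (hasFDerivAt_const v z)).fderiv
  have hΓ : HasFDerivAt (fun y : E × (E →L[ℝ] ℝ) ↦ christoffel G y.1)
      (fderiv ℝ (christoffel G) z.1 ∘L ContinuousLinearMap.fst ℝ E (E →L[ℝ] ℝ)) z :=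
    ((hG.contDiffAt_christoffel hz).differentiableAt (by simp)).hasFDerivAt.comp z hasFDerivAt_fst
  have h2 := ((hasFDerivAt_snd (𝕜 := ℝ) (p := z)).clm_apply
    ((hΓ.clm_apply (hasFDerivAt_const u z)).clm_apply (hasFDerivAt_const v z))).fderiv
  have h3 := DFunLike.congr_fun (h1.symm.trans h2) w
  simp at h3
  rw [h3]
  ring

end IsMetricOn
end LocalDerivatives

/-! ### The Nijenhuis tensor of the natural diagonal lift -/

section LocalNijenhuis

variable {E : Type*} [NormedAddCommGroup E] [NormedSpace ℝ E] [FiniteDimensional ℝ E]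
variable {G : E → E →L[ℝ] E →L[ℝ] ℝ} {U : Set E} {a₁ b₁ a₂ b₂ : ℝ → ℝ}
  {z : E × (E →L[ℝ] ℝ)}

omit [FiniteDimensional ℝ E] in
theorem localP_horizontalLift (G : E → E →L[ℝ] E →L[ℝ] ℝ) (a₁ b₁ a₂ b₂ : ℝ → ℝ)
    (z : E × (E →L[ℝ] ℝ)) (u : E) :
    localP G a₁ b₁ a₂ b₂ z (horizontalLift G z u) = (0, lowerTensor G a₁ b₁ z u) := by
  rw [localP_apply]
  simp [horizontalLift]

omit [FiniteDimensional ℝ E] in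
theorem localP_vertical (G : E → E →L[ℝ] E →L[ℝ] ℝ) (a₁ b₁ a₂ b₂ : ℝ → ℝ)
    (z : E × (E →L[ℝ] ℝ)) (α : E →L[ℝ] ℝ) :
    localP G a₁ b₁ a₂ b₂ z (0, α) = horizontalLift G z (upperTensor G a₂ b₂ z α) := by
  rw [localP_apply]
  simp [horizontalLift]

omit [FiniteDimensional ℝ E] in
theorem eq_horizontalLift_add_vertical (G : E → E →L[ℝ] E →L[ℝ] ℝ) (z w : E × (E →L[ℝ] ℝ)) :
    w = horizontalLift G z w.1 + (0, verticalPart G z w) := by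
  ext1 <;> simp [horizontalLift, verticalPart, horizontalPart]

/-- The coefficient of `p_i g_jk - p_j g_ik` in the Nijenhuis tensor of the lift, as a function of
the energy density `t`. -/
def torsionCoeff (a b : ℝ → ℝ) (t : ℝ) : ℝ :=
  derivWithin a (Ici 0) t * (a t + 2 * t * b t) - a t * b t

namespace IsMetricOn

/-- On two horizontal lifts `X^H` and `Y^H` the Nijenhuis tensor is the vertical vector
`[(L X)^V, (L Y)^V] + [X^H, Y^H]`, where the second bracket is given by the curvature: the other two
brackets cancel because the Levi-Civita connection is torsion free and `L` is parallel. -/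
theorem nijenhuisForm_horizontalLift (hG : IsMetricOn G U) (hz : z.1 ∈ U)
    (ha₁ : ContDiffOn ℝ ∞ a₁ (Ici 0)) (hb₁ : ContDiffOn ℝ ∞ b₁ (Ici 0))
    (ha₂ : ContDiffOn ℝ ∞ a₂ (Ici 0)) (hb₂ : ContDiffOn ℝ ∞ b₂ (Ici 0))
    (hP : ∀ v, localP G a₁ b₁ a₂ b₂ z (localP G a₁ b₁ a₂ b₂ z v) = v) (u v : E) :
    (nijenhuisForm (localP G a₁ b₁ a₂ b₂) z (horizontalLift G z u) (horizontalLift G z v)).1 = 0 ∧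
    ∀ w, (nijenhuisForm (localP G a₁ b₁ a₂ b₂) z (horizontalLift G z u)
        (horizontalLift G z v)).2 w =
      torsionCoeff a₁ b₁ (energy G z) * (z.2 u * G z.1 v w - z.2 v * G z.1 u w)
        + z.2 (curvature G z.1 u v w) := by
  have hQ := (hG.contDiffAt_localP hz ha₁ hb₁ ha₂ hb₂).differentiableAt (by simp)
  have hL (u : E) : HasFDerivAt (fun y ↦ lowerTensor G a₁ b₁ y u)
      (fderiv ℝ (fun y ↦ lowerTensor G a₁ b₁ y u) z) z :=
    (((hG.contDiffAt_lowerTensor hz ha₁ hb₁).clm_apply contDiffAt_const).differentiableAt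
      (by simp)).hasFDerivAt
  have hγ (u : E) : HasFDerivAt (fun y ↦ gammaZero G y u)
      (fderiv ℝ (fun y ↦ gammaZero G y u) z) z :=
    (((hG.contDiffAt_gammaZero hz).clm_apply contDiffAt_const).differentiableAt
      (by simp)).hasFDerivAt
  have hH (u : E) : HasFDerivAt (fun y ↦ horizontalLift G y u)
      ((0 : _ →L[ℝ] E).prod (fderiv ℝ (fun y ↦ gammaZero G y u) z)) z :=
    (hasFDerivAt_const u z).prodMk (hγ u)
  have hV (u : E) : HasFDerivAt (fun y ↦ ((0 : E), lowerTensor G a₁ b₁ y u))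
      ((0 : _ →L[ℝ] E).prod (fderiv ℝ (fun y ↦ lowerTensor G a₁ b₁ y u) z)) z :=
    (hasFDerivAt_const 0 z).prodMk (hL u)
  have h1 (u : E) : horizontalLift G z u = (u, gammaZero G z u) := rfl
  have hvh (u : E) : verticalPart G z (u, gammaZero G z u) = 0 := by
    ext; simp [verticalPart, horizontalPart]
  have hvv (α : E →L[ℝ] ℝ) : verticalPart G z (0, α) = α := by
    ext; simp [verticalPart, horizontalPart]
  have hmixed : fderiv ℝ (fun y ↦ gammaZero G y v) z (0, lowerTensor G a₁ b₁ z u)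
        - fderiv ℝ (fun y ↦ lowerTensor G a₁ b₁ y u) z (v, gammaZero G z v) =
      -(fderiv ℝ (fun y ↦ lowerTensor G a₁ b₁ y v) z (u, gammaZero G z u)
        - fderiv ℝ (fun y ↦ gammaZero G y u) z (0, lowerTensor G a₁ b₁ z v)) := by
    ext w
    simp [hG.fderiv_gammaZero hz, hG.fderiv_lowerTensor hz ha₁ hb₁, hvh,
      hG.christoffel_comm hz u v]
  have hN : nijenhuisForm (localP G a₁ b₁ a₂ b₂) z (horizontalLift G z u) (horizontalLift G z v) =
      (0, fderiv ℝ (fun y ↦ lowerTensor G a₁ b₁ y v) z (0, lowerTensor G a₁ b₁ z u)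
        - fderiv ℝ (fun y ↦ lowerTensor G a₁ b₁ y u) z (0, lowerTensor G a₁ b₁ z v)
        + (fderiv ℝ (fun y ↦ gammaZero G y v) z (u, gammaZero G z u)
          - fderiv ℝ (fun y ↦ gammaZero G y u) z (v, gammaZero G z v))) := by
    rw [← nijenhuisForm_eq_lieBracket (X := fun y ↦ horizontalLift G y u)
      (Y := fun y ↦ horizontalLift G y v) hQ (hH u).differentiableAt (hH v).differentiableAt]
    have h2 (u : E) : localP G a₁ b₁ a₂ b₂ z (u, gammaZero G z u) = (0, lowerTensor G a₁ b₁ z u) :=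
      localP_horizontalLift G a₁ b₁ a₂ b₂ z u
    simp only [localP_horizontalLift, VectorField.lieBracket, (hH _).fderiv, (hV _).fderiv, hP, h1,
      h2]
    have e1 (α β : E →L[ℝ] ℝ) : ((0 : E), α) - (0, β) = (0, α - β) := by simp
    simp only [ContinuousLinearMap.prod_apply, zero_apply, e1]
    rw [hmixed]
    have e2 (α : E →L[ℝ] ℝ) : ((0 : E), -α) = -(0, α) := by simp
    rw [e2, map_neg]
    ext1 <;> simp
  rw [hN]
  refine ⟨rfl, fun w ↦ ?_⟩
  have hξ : z.2 (sharp G z.1 z.2) = 2 * energy G z := by rw [energy]; ring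
  have hLs (u : E) : lowerTensor G a₁ b₁ z u (sharp G z.1 z.2) =
      (a₁ (energy G z) + 2 * energy G z * b₁ (energy G z)) * z.2 u := by
    rw [lowerTensor_apply, hξ, hG.symm _ hz, hG.apply_sharp hz]
    ring
  simp [hG.fderiv_gammaZero hz, hG.fderiv_lowerTensor hz ha₁ hb₁, hvv, hLs, curvature,
    gammaZero_apply, torsionCoeff]
  simp only [lowerTensor_apply, hG.symm _ hz v u]
  ring

/-- The Nijenhuis tensor of a natural diagonal almost product structure vanishes at a point iff it
vanishes on horizontal lifts, which is an equation for the curvature. -/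
theorem nijenhuisForm_eq_zero_iff (hG : IsMetricOn G U) (hz : z.1 ∈ U)
    (ha₁ : ContDiffOn ℝ ∞ a₁ (Ici 0)) (hb₁ : ContDiffOn ℝ ∞ b₁ (Ici 0))
    (ha₂ : ContDiffOn ℝ ∞ a₂ (Ici 0)) (hb₂ : ContDiffOn ℝ ∞ b₂ (Ici 0))
    (hP : ∀ᶠ y in 𝓝 z, ∀ v, localP G a₁ b₁ a₂ b₂ y (localP G a₁ b₁ a₂ b₂ y v) = v) :
    (∀ x y, nijenhuisForm (localP G a₁ b₁ a₂ b₂) z x y = 0) ↔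
      ∀ u v w, z.2 (curvature G z.1 u v w) =
        -torsionCoeff a₁ b₁ (energy G z) * (z.2 u * G z.1 v w - z.2 v * G z.1 u w) := by
  have hQ := (hG.contDiffAt_localP hz ha₁ hb₁ ha₂ hb₂).differentiableAt (by simp)
  have hN := hG.nijenhuisForm_horizontalLift hz ha₁ hb₁ ha₂ hb₂ hP.self_of_nhds
  constructor
  · intro h u v w
    have := (hN u v).2 w
    rw [h] at this
    simp only [Prod.snd_zero, zero_apply] at this
    linear_combination -this
  · intro h
    have hHH (u v : E) : nijenhuisForm (localP G a₁ b₁ a₂ b₂) z (horizontalLift G z u)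
        (horizontalLift G z v) = 0 := by
      refine Prod.ext (hN u v).1 ?_
      ext w
      rw [(hN u v).2, h]
      simp
    have hvert (α : E →L[ℝ] ℝ) : ((0 : E), α) = localP G a₁ b₁ a₂ b₂ z
        (horizontalLift G z (upperTensor G a₂ b₂ z α)) := by
      rw [← localP_vertical (a₁ := a₁) (b₁ := b₁), hP.self_of_nhds]
    have step (y : E × (E →L[ℝ] ℝ))
        (hy : ∀ u, nijenhuisForm (localP G a₁ b₁ a₂ b₂) z (horizontalLift G z u) y = 0)
        (x : E × (E →L[ℝ] ℝ)) : nijenhuisForm (localP G a₁ b₁ a₂ b₂) z x y = 0 := by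
      rw [eq_horizontalLift_add_vertical G z x, hvert, nijenhuisForm_add_left,
        nijenhuisForm_apply_left hQ hP, hy, hy]
      simp
    intro x y
    refine step y (fun u ↦ ?_) x
    rw [nijenhuisForm_swap, step _ (fun v ↦ hHH v u), neg_zero]

end IsMetricOn
end LocalNijenhuis

/-! ### Symmetries of the curvature tensor and constant curvature -/

section Curvature

/-- A form with the algebraic symmetries of a curvature tensor vanishes if its sectional values do.
Additivity is only needed in the first argument, as the symmetries carry it to the others. -/
theorem curvatureLike_eq_zero {E : Type*} [AddCommGroup E] (F : E → E → E → E → ℝ)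
    (hadd : ∀ u u' v w x, F (u + u') v w x = F u v w x + F u' v w x)
    (hanti : ∀ u v w x, F u v w x = -F v u w x) (hskew : ∀ u v w x, F u v w x = -F u v x w)
    (hbianchi : ∀ u v w x, F u v w x + F v w u x + F w u v x = 0)
    (hsec : ∀ u v, F u v v u = 0) (u v w x : E) : F u v w x = 0 := by
  have hadd2 (u v v' w x : E) : F u (v + v') w x = F u v w x + F u v' w x := by
    rw [hanti, hadd, hanti v, hanti v']; ring
  have hpair (u v w x : E) : F u v w x = F w x u v := by
    linarith [hbianchi u v w x, hbianchi v w x u, hbianchi w x u v, hbianchi x u v w,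
      hskew u v w x, hskew v w u x, hskew w x u v, hskew w u v x, hskew x u v w, hskew v x w u,
      hanti v x w u, hanti u w x v]
  have hadd3 (u v w w' x : E) : F u v (w + w') x = F u v w x + F u v w' x := by
    rw [hpair, hadd, hpair w, hpair w']
  have hadd4 (u v w x x' : E) : F u v w (x + x') = F u v w x + F u v w x' := by
    rw [hskew, hadd3, hskew u v x, hskew u v x']; ring
  have h1 (u v x : E) : F u v v x = 0 := by
    have := hsec (u + x) v
    rw [hadd, hadd4, hadd4, hsec, hsec, hpair x v v u] at this
    have h2 : F v u x v = F u v v x := by rw [hanti, hskew]; ring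
    linarith
  have h2 (u v w x : E) : F u v w x = -F u w v x := by
    have := h1 u (v + w) x
    rw [hadd2, hadd3, hadd3, h1, h1] at this
    linarith
  linarith [hbianchi u v w x, h2 u v w x, h2 v w u x, hanti v u w x, hanti w u v x]

variable {E : Type*} [NormedAddCommGroup E] [NormedSpace ℝ E] [FiniteDimensional ℝ E]
variable {G : E → E →L[ℝ] E →L[ℝ] ℝ} {U : Set E} {q : E}

omit [FiniteDimensional ℝ E] in
theorem curvature_swap (G : E → E →L[ℝ] E →L[ℝ] ℝ) (q u v w : E) :
    curvature G q u v w = -curvature G q v u w := by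
  simp only [curvature]
  abel

omit [FiniteDimensional ℝ E] in
theorem curvature_add_left (G : E → E →L[ℝ] E →L[ℝ] ℝ) (q u u' v w : E) :
    curvature G q (u + u') v w = curvature G q u v w + curvature G q u' v w := by
  simp only [curvature, map_add, add_apply]
  abel

namespace IsMetricOn

theorem fderiv_christoffel_comm (hG : IsMetricOn G U) (hq : q ∈ U) (w u v : E) :
    fderiv ℝ (christoffel G) q w u v = fderiv ℝ (christoffel G) q w v u := by
  have hd : DifferentiableAt ℝ (christoffel G) q :=
    (hG.contDiffAt_christoffel hq).differentiableAt (by simp)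
  have h1 (u v : E) := (hd.hasFDerivAt.clm_apply (hasFDerivAt_const u q)).clm_apply
    (hasFDerivAt_const v q)
  have h2 : (fun x ↦ christoffel G x u v) =ᶠ[𝓝 q] fun x ↦ christoffel G x v u :=
    Filter.eventually_of_mem (hG.isOpen.mem_nhds hq) fun x hx ↦ hG.christoffel_comm hx u v
  have := DFunLike.congr_fun ((h1 u v).unique ((h1 v u).congr_of_eventuallyEq h2)) w
  simpa using this

theorem bianchi (hG : IsMetricOn G U) (hq : q ∈ U) (u v w : E) :
    curvature G q u v w + curvature G q v w u + curvature G q w u v = 0 := by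
  simp only [curvature]
  rw [hG.fderiv_christoffel_comm hq u v w, hG.fderiv_christoffel_comm hq v u w,
    hG.fderiv_christoffel_comm hq w u v, hG.christoffel_comm hq v w, hG.christoffel_comm hq u w,
    hG.christoffel_comm hq v u]
  abel

/-- The curvature operators are skew: this follows from the symmetry of the second derivative of
the metric, expressed with the Christoffel symbols. -/
theorem apply_curvature_skew (hG : IsMetricOn G U) (hq : q ∈ U) (u v w x : E) :
    G q (curvature G q u v w) x = -G q (curvature G q u v x) w := by
  have hΓ : DifferentiableAt ℝ (christoffel G) q :=
    (hG.contDiffAt_christoffel hq).differentiableAt (by simp)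
  have hev (v w : E) : HasFDerivAt (fun y ↦ christoffel G y v w)
      (((fderiv ℝ (christoffel G) q).flip v).flip w) q :=
    ((hΓ.hasFDerivAt.clm_apply (hasFDerivAt_const v q)).clm_apply
      (hasFDerivAt_const w q)).congr_fderiv (by ext; simp)
  have hdd : DifferentiableAt ℝ (fderiv ℝ G) q :=
    (hG.contDiffAt_fderiv hq).differentiableAt (by simp)
  have key (u v : E) : fderiv ℝ (fderiv ℝ G) q u v w x =
      fderiv ℝ G q u (christoffel G q v w) x + G q (fderiv ℝ (christoffel G) q u v w) x
      + (fderiv ℝ G q u w (christoffel G q v x) + G q w (fderiv ℝ (christoffel G) q u v x)) := by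
    have e : (fun y ↦ fderiv ℝ G y v w x) =ᶠ[𝓝 q]
        fun y ↦ G y (christoffel G y v w) x + G y w (christoffel G y v x) :=
      Filter.eventually_of_mem (hG.isOpen.mem_nhds hq) fun y hy ↦ hG.fderiv_apply hy v w x
    have h1 := ((hdd.hasFDerivAt.clm_apply (hasFDerivAt_const v q)).clm_apply
      (hasFDerivAt_const w q)).clm_apply (hasFDerivAt_const x q)
    have hGd := (hG.differentiableAt hq).hasFDerivAt
    have h2 := ((hGd.clm_apply (hev v w)).clm_apply (hasFDerivAt_const x q)).add
      ((hGd.clm_apply (hasFDerivAt_const w q)).clm_apply (hev v x))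
    have h3 := DFunLike.congr_fun (h1.unique (h2.congr_of_eventuallyEq e)) u
    simp at h3
    rw [h3]
    ring
  have hsymm : fderiv ℝ (fderiv ℝ G) q u v w x = fderiv ℝ (fderiv ℝ G) q v u w x := by
    rw [((hG.contDiffAt hq).isSymmSndFDerivAt (by simpa using ENat.LEInfty.out)).eq u v]
  rw [key u v, key v u] at hsymm
  simp only [hG.fderiv_apply hq] at hsymm
  simp only [curvature, map_add, map_sub, add_apply, sub_apply]
  rw [hG.symm q hq (fderiv ℝ (christoffel G) q u v x) w,
    hG.symm q hq (fderiv ℝ (christoffel G) q v u x) w,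
    hG.symm q hq (christoffel G q u (christoffel G q v x)) w,
    hG.symm q hq (christoffel G q v (christoffel G q u x)) w]
  linear_combination hsymm

/-- If all sectional curvatures at a point are equal to `c`, they determine the curvature tensor
there. -/
theorem curvature_eq_of_sectional (hG : IsMetricOn G U) (hq : q ∈ U) {c : ℝ}
    (h : ∀ u v, G q (curvature G q u v v) u = c * (G q u u * G q v v - G q u v ^ 2))
    (u v w : E) : curvature G q u v w = c • (G q v w • u - G q u w • v) := by
  refine hG.eq_of_apply_eq hq fun x ↦ ?_
  rw [← sub_eq_zero]
  have := curvatureLike_eq_zero (fun u v w x ↦ G q (curvature G q u v w) x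
    - G q (c • (G q v w • u - G q u w • v)) x) ?_ ?_ ?_ ?_ ?_ u v w x
  · exact this
  · intro u u' v w x
    simp only [curvature_add_left, map_add, map_sub, map_smul, add_apply, sub_apply, smul_apply,
      smul_eq_mul]
    ring
  · intro u v w x
    rw [curvature_swap]
    simp only [map_sub, map_neg, map_smul, neg_apply, sub_apply, smul_apply, smul_eq_mul]
    ring
  · intro u v w x
    rw [hG.apply_curvature_skew hq]
    simp only [map_sub, map_smul, sub_apply, smul_apply, smul_eq_mul]
    ring
  · intro u v w x
    have hb := congrArg (fun y ↦ G q y x) (hG.bianchi hq u v w)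
    simp only [map_add, add_apply, map_zero, zero_apply] at hb
    simp only [map_sub, map_smul, sub_apply, smul_apply, smul_eq_mul]
    rw [hG.symm q hq w u, hG.symm q hq w v, hG.symm q hq v u]
    linear_combination hb
  · intro u v
    rw [h]
    simp only [map_sub, map_smul, sub_apply, smul_apply, smul_eq_mul]
    rw [hG.symm q hq v u]
    ring

end IsMetricOn
end Curvature

/-! ### The equations for the coefficients -/

section Coefficients

variable {a₁ b₁ a₂ b₂ : ℝ → ℝ} {c : ℝ}

theorem eq_const_of_eq_on_Ioi {f : ℝ → ℝ} (hf : ContinuousOn f (Ici 0)) {c : ℝ}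
    (h : ∀ t, 0 < t → f t = c) {t : ℝ} (ht : 0 ≤ t) : f t = c :=
  EqOn.of_subset_closure (s := Ioi 0) (t := Ici 0) (g := fun _ ↦ c) h hf continuousOn_const
    Ioi_subset_Ici_self (by rw [closure_Ioi]) ht

theorem continuousOn_derivWithin_Ici {a : ℝ → ℝ} (ha : ContDiffOn ℝ ∞ a (Ici 0)) :
    ContinuousOn (derivWithin a (Ici 0)) (Ici 0) :=
  ha.continuousOn_derivWithin (uniqueDiffOn_Ici 0) (by simp)

theorem hasDerivAt_of_contDiffOn_Ici {a : ℝ → ℝ} (ha : ContDiffOn ℝ ∞ a (Ici 0)) {t : ℝ}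
    (ht : 0 < t) : HasDerivAt a (derivWithin a (Ici 0) t) t :=
  ((ha.differentiableOn (by simp) t ht.le).hasDerivWithinAt).hasDerivAt (Ici_mem_nhds ht)

/-- A solution of a homogeneous linear equation `h' = k h` on `[0, ∞)` with `h(0) ≠ 0` has no
zeros. -/
theorem ne_zero_of_hasDerivAt_mul {h k : ℝ → ℝ} (hc : ContinuousOn h (Ici 0))
    (hk : ContinuousOn k (Ici 0)) (hd : ∀ t, 0 < t → HasDerivAt h (k t * h t) t) (h0 : h 0 ≠ 0)
    {t : ℝ} (ht : 0 ≤ t) : h t ≠ 0 := by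
  intro htz
  -- Grönwall's inequality for the reversed function `s ↦ h (t - s)`.
  obtain ⟨K, hK⟩ := isCompact_Icc.exists_bound_of_continuousOn
    (hk.mono (fun x (hx : x ∈ Icc 0 t) ↦ hx.1))
  have hmaps : MapsTo (fun s ↦ t - s) (Icc 0 t) (Ici 0) := fun s hs ↦ sub_nonneg.2 hs.2
  have := eq_zero_of_abs_deriv_le_mul_abs_self_of_eq_zero_right (f := fun s ↦ h (t - s))
    (f' := fun s ↦ -(k (t - s) * h (t - s))) (K := K) (a := 0) (b := t)
    (hc.comp (by fun_prop) hmaps) ?_ (by simpa using htz) ?_ t ⟨ht, le_rfl⟩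
  · exact h0 (by simpa using this)
  · intro s hs
    have h1 := (hd (t - s) (sub_pos.2 hs.2)).scomp s ((hasDerivAt_id s).const_sub t)
    simpa [Function.comp_def] using h1.hasDerivWithinAt
  · intro s hs
    rw [norm_neg, norm_mul]
    gcongr
    exact hK _ ⟨sub_nonneg.2 hs.2.le, by linarith [hs.1]⟩

/-- The coefficients of an integrable structure: `b₁` and `b₂` are determined by `a₁`, `a₂` and the
curvature `c`, and the denominators do not vanish. With `A = a₁ + 2 t b₁` and `h = a₁² + 2 c t`, the
integrability equation says `A (a₁ - 2 t a₁') = h`, so that `h` solves `h' = (2 b₁ / A) h`. -/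
theorem coefficients_of_torsionCoeff (ha₁ : ContDiffOn ℝ ∞ a₁ (Ici 0))
    (hb₁ : ContDiffOn ℝ ∞ b₁ (Ici 0)) (ha₂ : ContDiffOn ℝ ∞ a₂ (Ici 0))
    (h1 : ∀ t, 0 ≤ t → a₁ t * a₂ t = 1)
    (h2 : ∀ t, 0 ≤ t → a₂ t * b₁ t + a₁ t * b₂ t + 2 * t * b₁ t * b₂ t = 0)
    (hκ : ∀ t, 0 ≤ t → torsionCoeff a₁ b₁ t = -c) (t : ℝ) (ht : 0 ≤ t) :
    (a₁ t - 2 * t * derivWithin a₁ (Ici 0) t ≠ 0 ∧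
      b₁ t = (a₁ t * derivWithin a₁ (Ici 0) t + c) / (a₁ t - 2 * t * derivWithin a₁ (Ici 0) t)) ∧
    (a₁ t + 2 * c * t * a₂ t ≠ 0 ∧
      b₂ t = (a₁ t * derivWithin a₂ (Ici 0) t - a₂ t ^ 2 * c) / (a₁ t + 2 * c * t * a₂ t)) := by
  have hA (t : ℝ) (ht : 0 ≤ t) : a₁ t + 2 * t * b₁ t ≠ 0 := by
    intro h
    have : (a₁ t + 2 * t * b₁ t) * (a₂ t + 2 * t * b₂ t) = 1 := by
      linear_combination h1 t ht + 2 * t * h2 t ht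
    rw [h, zero_mul] at this
    exact zero_ne_one this
  have ha (t : ℝ) (ht : 0 ≤ t) : a₁ t ≠ 0 := left_ne_zero_of_mul_eq_one (h1 t ht)
  have hprod (t : ℝ) (ht : 0 ≤ t) : (a₁ t + 2 * t * b₁ t) *
      (a₁ t - 2 * t * derivWithin a₁ (Ici 0) t) = a₁ t ^ 2 + 2 * c * t := by
    have := hκ t ht
    rw [torsionCoeff] at this
    linear_combination -2 * t * this
  have hh : a₁ t ^ 2 + 2 * c * t ≠ 0 := by
    refine ne_zero_of_hasDerivAt_mul (h := fun t ↦ a₁ t ^ 2 + 2 * c * t)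
      (k := fun t ↦ 2 * b₁ t / (a₁ t + 2 * t * b₁ t)) ?_ ?_ ?_ ?_ ht
    · exact (ha₁.continuousOn.pow 2).add (by fun_prop)
    · refine (continuousOn_const.mul hb₁.continuousOn).div
        (ha₁.continuousOn.add (ContinuousOn.mul (by fun_prop) hb₁.continuousOn)) hA
    · intro t ht
      have hd := ((hasDerivAt_of_contDiffOn_Ici ha₁ ht).pow 2).add
        ((hasDerivAt_id t).const_mul (2 * c))
      refine hd.congr_deriv ?_
      have hκt := hκ t ht.le
      rw [torsionCoeff] at hκt
      have hAt := hA t ht.le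
      rw [← hprod t ht.le, div_mul_eq_mul_div, eq_div_iff hAt]
      simp
      linear_combination 2 * (a₁ t + 2 * t * b₁ t) * hκt
    · simpa using ha 0 le_rfl
  have hd₂ : derivWithin a₁ (Ici 0) t * a₂ t + a₁ t * derivWithin a₂ (Ici 0) t = 0 := by
    have e1 := (ha₁.differentiableOn (by simp) t ht).hasDerivWithinAt.mul
      (ha₂.differentiableOn (by simp) t ht).hasDerivWithinAt
    have e2 : HasDerivWithinAt (a₁ * a₂) 0 (Ici 0) t :=
      (hasDerivWithinAt_const t (Ici 0) (1 : ℝ)).congr_of_mem (fun s hs ↦ h1 s hs) ht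
    exact (uniqueDiffOn_Ici 0 t ht).eq_deriv _ e1 e2
  have hAt := hA t ht
  have hp := hprod t ht
  have hκt := hκ t ht
  rw [torsionCoeff] at hκt
  have hden₁ : a₁ t - 2 * t * derivWithin a₁ (Ici 0) t ≠ 0 := by
    intro h
    rw [h, mul_zero] at hp
    exact hh hp.symm
  have hden₂ : a₁ t + 2 * c * t * a₂ t ≠ 0 := by
    intro h
    apply hh
    linear_combination a₁ t * h - 2 * c * t * h1 t ht
  refine ⟨⟨hden₁, ?_⟩, hden₂, ?_⟩
  · rw [eq_div_iff hden₁]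
    linear_combination -hκt
  · rw [eq_div_iff hden₂]
    refine mul_left_cancel₀ (mul_ne_zero (ha t ht) hAt) ?_
    set d := derivWithin a₁ (Ici 0) t
    set d₂ := derivWithin a₂ (Ici 0) t
    -- Both sides are `-a₂ b₁ h`.
    have l1 : a₁ t * (a₁ t + 2 * c * t * a₂ t) = a₁ t ^ 2 + 2 * c * t := by
      linear_combination 2 * c * t * h1 t ht
    have l2 : b₂ t * (a₁ t + 2 * t * b₁ t) = -(a₂ t * b₁ t) := by linear_combination h2 t ht
    have r1 : a₁ t * (a₁ t * d₂ - a₂ t ^ 2 * c) = -a₂ t * (a₁ t * d + c) := by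
      linear_combination a₁ t * hd₂ - a₂ t * c * h1 t ht
    have r2 : a₁ t * d + c = b₁ t * (a₁ t - 2 * t * d) := by linear_combination hκt
    calc a₁ t * (a₁ t + 2 * t * b₁ t) * (b₂ t * (a₁ t + 2 * c * t * a₂ t))
        = (a₁ t * (a₁ t + 2 * c * t * a₂ t)) * (b₂ t * (a₁ t + 2 * t * b₁ t)) := by ring
      _ = (a₁ t ^ 2 + 2 * c * t) * -(a₂ t * b₁ t) := by rw [l1, l2]
      _ = -a₂ t * (b₁ t * (a₁ t - 2 * t * d)) * (a₁ t + 2 * t * b₁ t) := by rw [← hp]; ring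
      _ = (a₁ t * (a₁ t * d₂ - a₂ t ^ 2 * c)) * (a₁ t + 2 * t * b₁ t) := by rw [r1, r2]
      _ = a₁ t * (a₁ t + 2 * t * b₁ t) * (a₁ t * d₂ - a₂ t ^ 2 * c) := by ring

theorem torsionCoeff_eq_of_eq_div {t : ℝ} (h0 : a₁ t - 2 * t * derivWithin a₁ (Ici 0) t ≠ 0)
    (h : b₁ t = (a₁ t * derivWithin a₁ (Ici 0) t + c) /
      (a₁ t - 2 * t * derivWithin a₁ (Ici 0) t)) : torsionCoeff a₁ b₁ t = -c := by
  rw [eq_div_iff h0] at h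
  rw [torsionCoeff]
  linear_combination -h

end Coefficients

section Pointwise

variable {E : Type*} [NormedAddCommGroup E] [NormedSpace ℝ E] [FiniteDimensional ℝ E]
variable {G : E → E →L[ℝ] E →L[ℝ] ℝ} {U : Set E} {a₁ b₁ a₂ b₂ : ℝ → ℝ} {q : E}

namespace IsMetricOn

omit [FiniteDimensional ℝ E] in
theorem gram_pos (hG : IsMetricOn G U) (hq : q ∈ U) {u v : E} (h : LinearIndependent ℝ ![u, v]) :
    0 < G q u u * G q v v - G q u v ^ 2 := by
  have hu : u ≠ 0 := h.ne_zero 0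
  have huu := hG.pos q hq u hu
  have hw : G q u u • v - G q u v • u ≠ 0 := by
    intro hw
    rw [LinearIndependent.pair_iff] at h
    have := (h (-G q u v) (G q u u) (by rw [← hw]; module)).2
    exact huu.ne' this
  have := hG.pos q hq _ hw
  simp only [map_sub, map_smul, sub_apply, smul_apply, smul_eq_mul] at this
  rw [hG.symm q hq v u] at this
  have h2 : G q u u * (G q u u * G q v v - G q u v ^ 2) > 0 := by
    linarith
  exact pos_of_mul_pos_right h2 huu.le

theorem energy_smul (hG : IsMetricOn G U) (hq : q ∈ U) (s : ℝ) (u : E) :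
    energy G (q, s • G q u) = s ^ 2 / 2 * G q u u := by
  simp only [energy, map_smul, hG.sharp_apply hq, smul_apply, smul_eq_mul]
  ring

/-- Every nonnegative value of the energy density is attained on multiples of `G u`. -/
theorem exists_energy_eq (hG : IsMetricOn G U) (hq : q ∈ U) {u : E} (hu : u ≠ 0) {t : ℝ}
    (ht : 0 ≤ t) : ∃ s : ℝ, energy G (q, s • G q u) = t := by
  have huu := hG.pos q hq u hu
  refine ⟨√(2 * t / G q u u), ?_⟩
  rw [hG.energy_smul hq, Real.sq_sqrt (by positivity)]
  field_simp

/-- The two scalar equations which express that `P² = I`. -/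
theorem coefficients_of_localP_sq (hG : IsMetricOn G U) (hq : q ∈ U)
    (hE : 1 < Module.finrank ℝ E)
    (hP : ∀ (ξ : E →L[ℝ] ℝ) v,
      localP G a₁ b₁ a₂ b₂ (q, ξ) (localP G a₁ b₁ a₂ b₂ (q, ξ) v) = v) {t : ℝ} (ht : 0 ≤ t) :
    a₁ t * a₂ t = 1 ∧ t * (a₂ t * b₁ t + a₁ t * b₂ t + 2 * t * b₁ t * b₂ t) = 0 := by
  have : Nontrivial E := Module.nontrivial_of_finrank_pos (R := ℝ) (by omega)
  obtain ⟨u, hu⟩ := exists_ne (0 : E)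
  obtain ⟨v, hv⟩ := exists_linearIndependent_pair_of_one_lt_finrank hE hu
  have huu := hG.pos q hq u hu
  obtain ⟨s, hs⟩ := hG.exists_energy_eq hq hu ht
  have hs2 : s ^ 2 * G q u u = 2 * t := by
    rw [hG.energy_smul hq] at hs
    linarith
  have hUL (w : E) : (a₁ t * a₂ t) • w
      + ((a₂ t * b₁ t + a₁ t * b₂ t + 2 * t * b₁ t * b₂ t) * s ^ 2 * G q u w) • u = w := by
    have h1 := congrArg Prod.fst (hP (s • G q u) (horizontalLift G (q, s • G q u) w))
    rw [localP_horizontalLift, localP_vertical] at h1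
    have h2 : lowerTensor G a₁ b₁ (q, s • G q u) w =
        G q (a₁ t • w + (b₁ t * s ^ 2 * G q u w) • u) := by
      ext x
      simp only [lowerTensor_apply, hs, map_add, map_smul, add_apply, smul_apply, smul_eq_mul]
      ring
    have h3 (x : E) : (horizontalLift G (q, s • G q u) x).1 = x := rfl
    rw [h3, h3] at h1
    simp only [upperTensor_apply, hs, h2, hG.sharp_apply hq, map_smul, smul_apply, map_add,
      smul_eq_mul] at h1
    rw [← hs2]
    refine Eq.trans ?_ h1
    module
  have hw : G q u u • v - G q u v • u ≠ 0 := by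
    intro hw
    rw [LinearIndependent.pair_iff] at hv
    exact huu.ne' (hv (-G q u v) (G q u u) (by rw [← hw]; module)).2
  have h1 : a₁ t * a₂ t = 1 := by
    have h := hUL (G q u u • v - G q u v • u)
    have e : G q u (G q u u • v - G q u v • u) = 0 := by
      simp only [map_sub, map_smul, smul_eq_mul]
      ring
    rw [e, mul_zero, zero_smul, add_zero] at h
    exact smul_left_injective ℝ hw (h.trans (one_smul ℝ _).symm)
  refine ⟨h1, ?_⟩
  have h := hUL u
  rw [h1, one_smul, add_eq_left, smul_eq_zero_iff_left hu, mul_assoc, hs2] at h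
  linarith

end IsMetricOn
end Pointwise

/-! ### The lift on the manifold -/

section Global

variable {E : Type*} [NormedAddCommGroup E] [NormedSpace ℝ E]
  {M : Type*} [TopologicalSpace M] [ChartedSpace E M] [IsManifold 𝓘(ℝ, E) ∞ M]
  {g : ContMDiffRiemannianMetric 𝓘(ℝ, E) ∞ E (fun x : M ↦ TangentSpace 𝓘(ℝ, E) x)}
  {a₁ b₁ a₂ b₂ : ℝ → ℝ} {c : ℝ}

/-- Every covector in coordinates at `x` comes from a point of `T*M` over `x`. -/
theorem exists_extChartAt_cotangent_eq (x : M) (ξ : E →L[ℝ] ℝ) :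
    ∃ p : CotangentBundle E M, p.proj = x ∧
      extChartAt (cotangentModel E) p p = (extChartAt 𝓘(ℝ, E) x x, ξ) := by
  let D : TangentSpace 𝓘(ℝ, E) x →L[ℝ] E :=
    mfderiv 𝓘(ℝ, E) 𝓘(ℝ, E) (extChartAt 𝓘(ℝ, E) x) x
  refine ⟨⟨x, ξ ∘L D⟩, rfl, ?_⟩
  rw [extChartAt_cotangent_apply _ _ (mem_chart_source E x)]
  refine Prod.ext rfl ?_
  ext u
  have h := DFunLike.congr_fun (mfderiv_extChartAt_comp_mfderivWithin_extChartAt_symm'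
    (I := 𝓘(ℝ, E)) (mem_extChartAt_source x)) u
  rw [ModelWithCorners.range_eq_univ, mfderivWithin_univ] at h
  exact congrArg ξ h

/-- The sectional curvature in terms of the metric coefficients only: the denominator of the
definition is also expressed in the chart. -/
theorem sectionalCurvature_eq (x : M) (u v : TangentSpace 𝓘(ℝ, E) x) :
    let D : TangentSpace 𝓘(ℝ, E) x →L[ℝ] E :=
      mfderiv 𝓘(ℝ, E) 𝓘(ℝ, E) (extChartAt 𝓘(ℝ, E) x) x
    let G := chartMetric g x (extChartAt 𝓘(ℝ, E) x x)
    sectionalCurvature g x u v =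
      G (curvature (chartMetric g x) (extChartAt 𝓘(ℝ, E) x x) (D u) (D v) (D v)) (D u)
        / (G (D u) (D u) * G (D v) (D v) - G (D u) (D v) ^ 2) := by
  intro D G
  have hD (u : TangentSpace 𝓘(ℝ, E) x) :
      (mfderiv 𝓘(ℝ, E) 𝓘(ℝ, E) (extChartAt 𝓘(ℝ, E) x).symm (extChartAt 𝓘(ℝ, E) x x) (D u) : E) =
        u := by
    have h := DFunLike.congr_fun (mfderivWithin_extChartAt_symm_comp_mfderiv_extChartAt'
      (I := 𝓘(ℝ, E)) (mem_extChartAt_source x)) u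
    rw [ModelWithCorners.range_eq_univ, mfderivWithin_univ] at h
    exact h
  have hG (u v : TangentSpace 𝓘(ℝ, E) x) : G (D u) (D v) = g.inner x u v := by
    refine (chartMetric_apply g (extChartAt_to_inv x) (D u) (D v)).trans ?_
    rw [hD, hD]
  rw [hG u u, hG v v, hG u v]
  rfl

theorem isInvertible_mfderiv_extChartAt_self (x : M) :
    (mfderiv 𝓘(ℝ, E) 𝓘(ℝ, E) (extChartAt 𝓘(ℝ, E) x) x).IsInvertible :=
  isInvertible_mfderiv_extChartAt (mem_extChartAt_source x)

theorem hasConstantSectionalCurvature_iff :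
    HasConstantSectionalCurvature g c ↔ ∀ (x : M) (u v : E), LinearIndependent ℝ ![u, v] →
      let G := chartMetric g x (extChartAt 𝓘(ℝ, E) x x)
      G (curvature (chartMetric g x) (extChartAt 𝓘(ℝ, E) x x) u v v) u =
        c * (G u u * G v v - G u v ^ 2) := by
  refine forall_congr' fun x ↦ ?_
  obtain ⟨e, he⟩ := isInvertible_mfderiv_extChartAt_self (E := E) x
  have hli (u v : TangentSpace 𝓘(ℝ, E) x) :
      LinearIndependent ℝ ![u, v] ↔ LinearIndependent ℝ ![(e u : E), (e v : E)] := by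
    rw [LinearIndependent.pair_iff, LinearIndependent.pair_iff]
    simp only [← map_smul, ← map_add, EmbeddingLike.map_eq_zero_iff]
  have hm := isMetricOn_chartMetric g x
  have hsec (u v : TangentSpace 𝓘(ℝ, E) x) (h : LinearIndependent ℝ ![u, v]) :
      sectionalCurvature g x u v = c ↔
      chartMetric g x (extChartAt 𝓘(ℝ, E) x x)
        (curvature (chartMetric g x) (extChartAt 𝓘(ℝ, E) x x) (e u) (e v) (e v)) (e u) =
        c * (chartMetric g x (extChartAt 𝓘(ℝ, E) x x) (e u) (e u) *
          chartMetric g x (extChartAt 𝓘(ℝ, E) x x) (e v) (e v) -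
          chartMetric g x (extChartAt 𝓘(ℝ, E) x x) (e u) (e v) ^ 2) := by
    rw [sectionalCurvature_eq, ← he]
    exact div_eq_iff (hm.gram_pos (mem_extChartAt_target x) ((hli u v).1 h)).ne'
  constructor
  · intro h u v huv
    obtain ⟨u, rfl⟩ := e.surjective u
    obtain ⟨v, rfl⟩ := e.surjective v
    have h1 := (hli u v).2 huv
    exact (hsec u v h1).1 (h u v h1)
  · intro h u v huv
    exact (hsec u v huv).2 (h _ _ ((hli u v).1 huv))

variable [FiniteDimensional ℝ E]

/-- Constant sectional curvature determines the curvature tensor. -/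
theorem HasConstantSectionalCurvature.curvature_eq (h : HasConstantSectionalCurvature g c) (x : M)
    (u v w : E) :
    curvature (chartMetric g x) (extChartAt 𝓘(ℝ, E) x x) u v w =
      c • (chartMetric g x (extChartAt 𝓘(ℝ, E) x x) v w • u
        - chartMetric g x (extChartAt 𝓘(ℝ, E) x x) u w • v) := by
  refine (isMetricOn_chartMetric g x).curvature_eq_of_sectional (mem_extChartAt_target x) ?_ u v w
  intro u v
  by_cases huv : LinearIndependent ℝ ![u, v]
  · exact hasConstantSectionalCurvature_iff.1 h x u v huv
  · -- For linearly dependent `u`, `v` both sides vanish.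
    rcases eq_or_ne u 0 with rfl | hu
    · simp
    · rw [LinearIndependent.pair_iff' hu] at huv
      push Not at huv
      obtain ⟨r, rfl⟩ := huv
      have h0 (w : E) : curvature (chartMetric g x) (extChartAt 𝓘(ℝ, E) x x) u (r • u) w = 0 := by
        simp only [curvature, map_smul, smul_apply]
        abel
      rw [h0]
      simp only [map_smul, smul_apply, smul_eq_mul, map_zero, zero_apply]
      ring

/-- `P² = I` in the chart of `T*M` at `p`, not only at `p` but in a neighbourhood. -/
theorem localP_sq_of_isAlmostProduct
    (hP : IsAlmostProduct (naturalDiagonalLift g a₁ b₁ a₂ b₂)) (p : CotangentBundle E M) :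
    ∀ᶠ y in 𝓝 (extChartAt (cotangentModel E) p p), ∀ v,
      localP (chartMetric g p.proj) a₁ b₁ a₂ b₂ y
        (localP (chartMetric g p.proj) a₁ b₁ a₂ b₂ y v) = v := by
  filter_upwards [extChartAt_target_mem_nhds (I := cotangentModel E) p] with y hy v
  have hw := (extChartAt (cotangentModel E) p).map_target hy
  obtain ⟨v', rfl⟩ := (isInvertible_chartDeriv hw).surjective v
  have h := chartDeriv_naturalDiagonalLift g a₁ b₁ a₂ b₂ p _ (mem_extChartAt_cotangent_source.1 hw)
  rw [(extChartAt (cotangentModel E) p).right_inv hy] at h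
  rw [← h, ← h, hP]

/-- Integrability is the equation between the curvature and the coefficients. -/
theorem isIntegrable_naturalDiagonalLift_iff
    (ha₁ : ContDiffOn ℝ ∞ a₁ (Ici 0)) (hb₁ : ContDiffOn ℝ ∞ b₁ (Ici 0))
    (ha₂ : ContDiffOn ℝ ∞ a₂ (Ici 0)) (hb₂ : ContDiffOn ℝ ∞ b₂ (Ici 0))
    (hP : IsAlmostProduct (naturalDiagonalLift g a₁ b₁ a₂ b₂)) :
    IsIntegrable (naturalDiagonalLift g a₁ b₁ a₂ b₂) ↔ ∀ (x : M) (ξ : E →L[ℝ] ℝ) (u v w : E),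
      ξ (curvature (chartMetric g x) (extChartAt 𝓘(ℝ, E) x x) u v w) =
        -torsionCoeff a₁ b₁ (energy (chartMetric g x) (extChartAt 𝓘(ℝ, E) x x, ξ)) *
          (ξ u * chartMetric g x (extChartAt 𝓘(ℝ, E) x x) v w
            - ξ v * chartMetric g x (extChartAt 𝓘(ℝ, E) x x) u w) := by
  have hmem (p : CotangentBundle E M) :
      (extChartAt (cotangentModel E) p p).1 ∈ (extChartAt 𝓘(ℝ, E) p.proj).target := by
    rw [extChartAt_cotangent_apply p p (mem_chart_source E p.proj)]
    exact mem_extChartAt_target p.proj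
  rw [isIntegrable_iff_nijenhuisForm (Q := fun p ↦ localP (chartMetric g p.proj) a₁ b₁ a₂ b₂)
    (fun p ↦ ((isMetricOn_chartMetric g p.proj).contDiffAt_localP (hmem p) ha₁ hb₁ ha₂
      hb₂).differentiableAt (by simp))
    (fun p w hw ↦ chartDeriv_naturalDiagonalLift g a₁ b₁ a₂ b₂ p w
      (mem_extChartAt_cotangent_source.1 hw))]
  have hiff (p : CotangentBundle E M) :=
    (isMetricOn_chartMetric g p.proj).nijenhuisForm_eq_zero_iff (hmem p) ha₁ hb₁ ha₂ hb₂
      (localP_sq_of_isAlmostProduct hP p)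
  constructor
  · intro h x ξ
    obtain ⟨p, rfl, hp⟩ := exists_extChartAt_cotangent_eq x ξ
    have := (hiff p).1 (h p)
    rwa [hp] at this
  · intro h p
    refine (hiff p).2 ?_
    rw [extChartAt_cotangent_apply p p (mem_chart_source E p.proj)]
    exact h p.proj _

/-- The two scalar equations on the coefficients which express `P² = I`. -/
theorem IsAlmostProduct.coefficients [Nonempty M] (hE : 1 < Module.finrank ℝ E)
    (ha₁ : ContDiffOn ℝ ∞ a₁ (Ici 0)) (hb₁ : ContDiffOn ℝ ∞ b₁ (Ici 0))
    (ha₂ : ContDiffOn ℝ ∞ a₂ (Ici 0)) (hb₂ : ContDiffOn ℝ ∞ b₂ (Ici 0))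
    (hP : IsAlmostProduct (naturalDiagonalLift g a₁ b₁ a₂ b₂)) (t : ℝ) (ht : 0 ≤ t) :
    a₁ t * a₂ t = 1 ∧ a₂ t * b₁ t + a₁ t * b₂ t + 2 * t * b₁ t * b₂ t = 0 := by
  obtain ⟨x⟩ := ‹Nonempty M›
  have h (t : ℝ) (ht : 0 ≤ t) := (isMetricOn_chartMetric g x).coefficients_of_localP_sq
    (mem_extChartAt_target x) hE (a₁ := a₁) (b₁ := b₁) (a₂ := a₂) (b₂ := b₂) (fun ξ v ↦ by
      obtain ⟨p, rfl, hp⟩ := exists_extChartAt_cotangent_eq x ξ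
      have := (localP_sq_of_isAlmostProduct hP p).self_of_nhds v
      rwa [hp] at this) ht
  refine ⟨(h t ht).1, ?_⟩
  -- The second equation is only visible for `t > 0`, and extends to `t = 0` by continuity.
  refine eq_const_of_eq_on_Ioi
    (f := fun t ↦ a₂ t * b₁ t + a₁ t * b₂ t + 2 * t * b₁ t * b₂ t) ?_ ?_ ht
  · exact ((ha₂.continuousOn.mul hb₁.continuousOn).add
      (ha₁.continuousOn.mul hb₂.continuousOn)).add
      ((ContinuousOn.mul (by fun_prop) hb₁.continuousOn).mul hb₂.continuousOn)
  · intro t ht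
    exact (mul_eq_zero.1 (h t ht.le).2).resolve_left ht.ne'

/-- If the lift is integrable, the sectional curvatures are all equal to minus the value of the
coefficient `torsionCoeff` at any `t > 0`: evaluate the curvature equation on the multiple of the
covector dual to `u` which has energy density `t`. -/
theorem IsIntegrable.apply_curvature_eq
    (ha₁ : ContDiffOn ℝ ∞ a₁ (Ici 0)) (hb₁ : ContDiffOn ℝ ∞ b₁ (Ici 0))
    (ha₂ : ContDiffOn ℝ ∞ a₂ (Ici 0)) (hb₂ : ContDiffOn ℝ ∞ b₂ (Ici 0))
    (hP : IsAlmostProduct (naturalDiagonalLift g a₁ b₁ a₂ b₂))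
    (hI : IsIntegrable (naturalDiagonalLift g a₁ b₁ a₂ b₂)) (x : M) {u : E} (hu : u ≠ 0) (v : E)
    {t : ℝ} (ht : 0 < t) :
    let G := chartMetric g x (extChartAt 𝓘(ℝ, E) x x)
    G (curvature (chartMetric g x) (extChartAt 𝓘(ℝ, E) x x) u v v) u =
      -torsionCoeff a₁ b₁ t * (G u u * G v v - G u v ^ 2) := by
  intro G
  have hm := isMetricOn_chartMetric g x
  have hq := mem_extChartAt_target (I := 𝓘(ℝ, E)) x
  obtain ⟨s, hs⟩ := hm.exists_energy_eq hq hu ht.le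
  have hs0 : s ≠ 0 := by
    rintro rfl
    rw [hm.energy_smul hq] at hs
    simp at hs
    exact ht.ne hs
  have h := (isIntegrable_naturalDiagonalLift_iff ha₁ hb₁ ha₂ hb₂ hP).1 hI x (s • G u) u v v
  rw [hs] at h
  simp only [smul_apply, smul_eq_mul] at h
  refine mul_left_cancel₀ hs0 ?_
  rw [hm.symm _ hq, h]
  ring

end Global

end NatDiag

end

theorem theorem3p4 {n : ℕ} (hn : 2 < n)
    {M : Type*} [TopologicalSpace M] [ChartedSpace (EuclideanSpace ℝ (Fin n)) M]
    [IsManifold 𝓘(ℝ, EuclideanSpace ℝ (Fin n)) ∞ M] [ConnectedSpace M]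
    (g : ContMDiffRiemannianMetric 𝓘(ℝ, EuclideanSpace ℝ (Fin n)) ∞ (EuclideanSpace ℝ (Fin n))
      (fun x : M ↦ TangentSpace 𝓘(ℝ, EuclideanSpace ℝ (Fin n)) x))
    (a₁ b₁ a₂ b₂ : ℝ → ℝ)
    (ha₁ : ContDiffOn ℝ ∞ a₁ (Set.Ici 0)) (hb₁ : ContDiffOn ℝ ∞ b₁ (Set.Ici 0))
    (ha₂ : ContDiffOn ℝ ∞ a₂ (Set.Ici 0)) (hb₂ : ContDiffOn ℝ ∞ b₂ (Set.Ici 0))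
    (hP : NatDiag.IsAlmostProduct (NatDiag.naturalDiagonalLift g a₁ b₁ a₂ b₂)) :
    NatDiag.IsIntegrable (NatDiag.naturalDiagonalLift g a₁ b₁ a₂ b₂) ↔
      ∃ c : ℝ, NatDiag.HasConstantSectionalCurvature g c ∧
        ∀ t : ℝ, 0 ≤ t →
          (a₁ t - 2 * t * derivWithin a₁ (Set.Ici 0) t ≠ 0 ∧
            b₁ t = (a₁ t * derivWithin a₁ (Set.Ici 0) t + c) /
              (a₁ t - 2 * t * derivWithin a₁ (Set.Ici 0) t)) ∧
          (a₁ t + 2 * c * t * a₂ t ≠ 0 ∧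
            b₂ t = (a₁ t * derivWithin a₂ (Set.Ici 0) t - a₂ t ^ 2 * c) /
              (a₁ t + 2 * c * t * a₂ t)) := by
  have hE : 1 < Module.finrank ℝ (EuclideanSpace ℝ (Fin n)) := by
    rw [finrank_euclideanSpace_fin]
    omega
  have hcoeff := hP.coefficients hE ha₁ hb₁ ha₂ hb₂
  constructor
  · intro hI
    have hsec := fun x u hu v t ht ↦
      hI.apply_curvature_eq ha₁ hb₁ ha₂ hb₂ hP x (u := u) hu v (t := t) ht
    refine ⟨-NatDiag.torsionCoeff a₁ b₁ 1, ?_, ?_⟩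
    · exact NatDiag.hasConstantSectionalCurvature_iff.2
        fun x u v huv ↦ hsec x u (huv.ne_zero 0) v 1 one_pos
    · refine NatDiag.coefficients_of_torsionCoeff ha₁ hb₁ ha₂ (fun t ht ↦ (hcoeff t ht).1)
        (fun t ht ↦ (hcoeff t ht).2) fun t ht ↦ ?_
      rw [neg_neg]
      refine NatDiag.eq_const_of_eq_on_Ioi (f := NatDiag.torsionCoeff a₁ b₁) ?_ ?_ ht
      · exact ((NatDiag.continuousOn_derivWithin_Ici ha₁).mul (ha₁.continuousOn.add
          (ContinuousOn.mul (by fun_prop) hb₁.continuousOn))).sub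
          (ha₁.continuousOn.mul hb₁.continuousOn)
      · intro t ht
        have : Nontrivial (EuclideanSpace ℝ (Fin n)) :=
          Module.nontrivial_of_finrank_pos (R := ℝ) (by omega)
        obtain ⟨x⟩ : Nonempty M := inferInstance
        obtain ⟨u, hu⟩ := exists_ne (0 : EuclideanSpace ℝ (Fin n))
        obtain ⟨v, hv⟩ := exists_linearIndependent_pair_of_one_lt_finrank hE hu
        have hpos := (NatDiag.isMetricOn_chartMetric g x).gram_pos (mem_extChartAt_target x) hv
        exact neg_injective
          (mul_right_cancel₀ hpos.ne' ((hsec x u hu v t ht).symm.trans (hsec x u hu v 1 one_pos)))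
  · rintro ⟨c, hc, h⟩
    refine (NatDiag.isIntegrable_naturalDiagonalLift_iff ha₁ hb₁ ha₂ hb₂ hP).2
      fun x ξ u v w ↦ ?_
    have ht := (NatDiag.isMetricOn_chartMetric g x).energy_nonneg
      (z := (extChartAt 𝓘(ℝ, EuclideanSpace ℝ (Fin n)) x x, ξ)) (mem_extChartAt_target x)
    rw [NatDiag.torsionCoeff_eq_of_eq_div (h _ ht).1.1 (h _ ht).1.2, hc.curvature_eq]
    simp only [map_smul, map_sub, smul_eq_mul]
    ring
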